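/- Let $\mathcal R(s)=\int_{0\swarrow1}\frac{x^{-s}e^{\pi i x^2}}{e^{\pi i x}-e^{-\pi i x}}\,dx$ be Riemann's auxiliary function; here the integral is along a straight line of direction $e^{-3\pi i/4}$ that crosses the real axis between $0$ and $1$ and is run through from the upper right to the lower left, and $x^{-s}$ is the principal branch. Let $\chi(s)=2(2\pi)^{s-1}\sin(\pi s/2)\,\Gamma(1-s)$ be the factor in the functional equation $\zeta(s)=\chi(s)\zeta(1-s)$. For $s=\sigma+it$ with $0<\arg(s-1)<2\pi$, put $\eta=\sqrt{\frac{s-1}{2\pi i}}$ with $-\frac{\pi}{4}<\arg\eta<\frac{3\pi}{4}$, and let $\eta^{s-1}$ be formed with this value of $\arg\eta$. Let $0<\alpha<\frac{\pi}{4}$, and let $G_\alpha$ be the closed set of all $s=\sigma+it\in\mathbb C$ with $|t|\tan 2\alpha\le 1-\sigma$. Then, as $s\to\infty$ with $s\in G_\alpha$, $$\mathcal R(s)=\frac{e^{-\pi i/8}}{\sqrt2}\,\chi(s)\,\eta^{s-1}e^{\pi i(\eta-\eta^2)}\bigl(1+O(|\eta|^{-1})\bigr),$$ where the constant implied by $O$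 may depend on $\alpha$. -/

import Mathlib

open Filter Asymptotics

noncomputable section

namespace RiemannAux

/-- The straight line `0 ↙ 1`, parametrized by arc length: it runs from the upper right to the
lower left, in the direction `e^{-3πi/4}`, and meets the real axis only at `1/2`.  (By Cauchy's
theorem every crossing point between `0` and `1` gives the same integral below.) -/
def path (u : ℝ) : ℂ :=
  1 / 2 + (u : ℂ) * Complex.exp (-(3 * Real.pi * Complex.I / 4))

/-- The integrand `x^{-s} e^{πix²} / (e^{πix} - e^{-πix})`, with the principal branch of `x^{-s}`
(the line `0 ↙ 1` does not meet the cut along the nonpositive real axis). -/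
def integrand (s x : ℂ) : ℂ :=
  x ^ (-s) * Complex.exp (Real.pi * Complex.I * x ^ 2) /
    (Complex.exp (Real.pi * Complex.I * x) - Complex.exp (-(Real.pi * Complex.I * x)))

/-- Riemann's auxiliary function `𝓡(s) = ∫_{0↙1} x^{-s} e^{πix²} / (e^{πix} - e^{-πix}) dx`;
the constant factor is `dx/du`. -/
def auxR (s : ℂ) : ℂ :=
  ∫ u : ℝ, integrand s (path u) * Complex.exp (-(3 * Real.pi * Complex.I / 4))

/-- The factor of the functional equation `ζ(s) = χ(s) ζ(1-s)`. -/
def chi (s : ℂ) : ℂ :=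
  2 * (2 * Real.pi : ℂ) ^ (s - 1) * Complex.sin (Real.pi * s / 2) * Complex.Gamma (1 - s)

/-- The saddle point: `η` is the square root of `(s-1)/(2πi)` with `-π/4 < arg η < 3π/4`, for `s`
off the ray `[1, ∞)`; see `eta_sq` and `arg_eta_mem`. -/
def eta (s : ℂ) : ℂ :=
  Complex.exp (Real.pi * Complex.I / 4) * ((1 - s) / (2 * Real.pi)) ^ (1 / 2 : ℂ)

/-- The closed set `G_α`, defined by `|t| tan 2α ≤ 1 - σ` for `s = σ + it`. -/
def G (α : ℝ) : Set ℂ :=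
  {s | |s.im| * Real.tan (2 * α) ≤ 1 - s.re}

theorem chi_functional_equation {s : ℂ} (hs : ∀ n : ℕ, s ≠ n + 1) (hs0 : s ≠ 0) :
    riemannZeta s = chi s * riemannZeta (1 - s) := by
  have h := riemannZeta_one_sub (s := 1 - s)
    (fun n h => hs n (by linear_combination -h)) (fun h => hs0 (by linear_combination -h))
  have e : (Real.pi : ℂ) * (1 - s) / 2 = Real.pi / 2 - Real.pi * s / 2 := by ring
  rw [sub_sub_cancel, neg_sub, e, Complex.cos_pi_div_two_sub] at h
  rw [h, chi]
  ring

theorem eta_sq (s : ℂ) : eta s ^ 2 = (s - 1) / (2 * Real.pi * Complex.I) := by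
  have hpi : (Real.pi : ℂ) ≠ 0 := by exact_mod_cast Real.pi_ne_zero
  have h1 : Complex.exp (Real.pi * Complex.I / 4) ^ 2 = Complex.I := by
    have e : ((2 : ℕ) : ℂ) * (Real.pi * Complex.I / 4) = Real.pi / 2 * Complex.I := by
      push_cast
      ring
    rw [← Complex.exp_nat_mul, e, Complex.exp_pi_div_two_mul_I]
  have h2 : (((1 - s) / (2 * Real.pi)) ^ (1 / 2 : ℂ)) ^ 2 = (1 - s) / (2 * Real.pi) := by
    simp
  rw [eta, mul_pow, h1, h2]
  field_simp
  linear_combination (1 - s) * Complex.I_sq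

theorem arg_eta_mem {s : ℂ} (hs : 1 - s ∈ Complex.slitPlane) :
    -(Real.pi / 4) < (eta s).arg ∧ (eta s).arg < 3 * Real.pi / 4 := by
  have hpi := Real.pi_pos
  set z : ℂ := (1 - s) / (2 * Real.pi) with hz
  have hz' : z = (((2 * Real.pi)⁻¹ : ℝ) : ℂ) * (1 - s) := by
    rw [hz]; push_cast; rw [div_eq_inv_mul]
  have harg : z.arg = (1 - s).arg := by
    rw [hz', Complex.arg_real_mul _ (by positivity)]
  have hlt := (Complex.mem_slitPlane_iff_arg.1 hs)
  have h1 : z.arg < Real.pi := by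
    rw [harg]; exact lt_of_le_of_ne (Complex.arg_le_pi _) hlt.1
  have h2 : -Real.pi < z.arg := Complex.neg_pi_lt_arg _
  have hz0 : z ≠ 0 := by
    rw [hz']
    exact mul_ne_zero (by exact_mod_cast (by positivity : (2 * Real.pi)⁻¹ ≠ 0)) hlt.2
  have key : eta s = Complex.exp ((Real.log ‖z‖ / 2 : ℝ) + (Real.pi / 4 + z.arg / 2 : ℝ) * Complex.I) := by
    rw [eta, ← hz, Complex.cpow_def_of_ne_zero hz0, ← Complex.exp_add, Complex.log]
    congr 1
    push_cast
    ring
  have : (eta s).arg = Real.pi / 4 + z.arg / 2 := by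
    rw [key, Complex.exp_add, ← Complex.ofReal_exp, Complex.arg_real_mul _ (Real.exp_pos _),
      Complex.arg_exp_mul_I, toIocMod_eq_self]
    constructor <;> linarith
  rw [this]
  constructor <;> linarith

theorem isClosed_G (α : ℝ) : IsClosed (G α) :=
  isClosed_le (by fun_prop) (by fun_prop)

end RiemannAux

end

namespace RiemannAux

open MeasureTheory Set Complex Topology

/-! Put `τ = 1 - s`; on `G α` this lies in a closed sector inside the right half-plane. For `Re s <
-1` the pole of the integrand at `0` is cancelled by `x^{-s}`, so the line `0 ↙ 1` may pass through
`0`. The symmetry `x ↦ -x` folds it into one ray, with the factor `e^{πis} - 1` that supplies the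
sine in `χ` (`auxR_eq_integral_ray`). The ray is then turned to pass through `η`, the saddle point
of `x^τ e^{πix²}`.

With `x = ηv` the large exponent is `-τ · phase v`, since `πiη² = -τ/2`. The denominator leaves the
amplitude `e^{b(v-1)} / (1 - e^{2bv})` with `b = πiη`. As `b` has order `√|τ|`, the factor
`e^{b(v-1)}` is not negligible on the scale `|v - 1| ~ |τ|^{-1/2}`. It stays in the Gaussian and
contributes `e^{b²/(4τ)} = e^{-πi/8}`, while `e^{2bv}` is negligible near the saddle because `Im η`
is comparable to `|η|`.

`Γ(τ)` is a saddle point integral with the same phase, parameter `2τ` and amplitude `1`. Dividing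
the two gives an exact formula (`auxR_eq`), so Stirling's formula is not needed separately. The
uniform estimate `saddle_point_estimate` has error `O(|τ|⁻¹)` against main terms of order
`|τ|^{-1/2}`; the quotient thus has relative error `O(|η|⁻¹)`. -/

/-! ### Integrals along horizontal lines -/

theorem integrable_horizontal_line {H : ℂ → ℂ} {y M C : ℝ}
    (hc : Continuous fun a : ℝ => H (a + y * I))
    (hb : ∀ a : ℝ, M ≤ |a| → ‖H (a + y * I)‖ ≤ C * (1 + a ^ 2)⁻¹) :
    Integrable fun a : ℝ => H (a + y * I) := by
  have hO : ∀ l : Filter ℝ, (∀ᶠ a in l, M ≤ |a|) →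
      (fun a : ℝ => H (a + y * I)) =O[l] fun a : ℝ => (1 + a ^ 2)⁻¹ := by
    intro l hl
    refine IsBigO.of_bound C ?_
    filter_upwards [hl] with a ha
    rw [Real.norm_of_nonneg (by positivity)]
    exact hb a ha
  exact hc.locallyIntegrable.integrable_of_isBigO_atBot_atTop
    (hO _ (tendsto_abs_atBot_atTop.eventually_ge_atTop M))
    (integrable_inv_one_add_sq.integrableAtFilter _)
    (hO _ (tendsto_abs_atTop_atTop.eventually_ge_atTop M))
    (integrable_inv_one_add_sq.integrableAtFilter _)

/-- Cauchy's theorem for two horizontal lines bounding a strip. -/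
theorem integral_horizontal_line_eq {H : ℂ → ℂ} {y₁ y₂ M C : ℝ}
    (hc : ContinuousOn H {w | w.im ∈ uIcc y₁ y₂})
    (hd : DifferentiableOn ℂ H {w | w.im ∈ Ioo (min y₁ y₂) (max y₁ y₂)})
    (hb : ∀ a y : ℝ, M ≤ |a| → y ∈ uIcc y₁ y₂ → ‖H (a + y * I)‖ ≤ C * (1 + a ^ 2)⁻¹) :
    ∫ a : ℝ, H (a + y₁ * I) = ∫ a : ℝ, H (a + y₂ * I) := by
  have hint : ∀ y ∈ uIcc y₁ y₂, Integrable (fun a : ℝ => H (a + y * I)) := fun y hy =>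
    integrable_horizontal_line
      (hc.comp_continuous (by fun_prop) (fun a => by simpa using hy)) (fun a ha => hb a y ha hy)
  have hline : ∀ y ∈ uIcc y₁ y₂, Tendsto (fun R : ℝ => ∫ a in (-R)..R, H (a + y * I)) atTop
      (𝓝 (∫ a : ℝ, H (a + y * I))) := fun y hy =>
    intervalIntegral_tendsto_integral (hint y hy) tendsto_neg_atTop_atBot tendsto_id
  have hlim : Tendsto (fun R : ℝ => C * (1 + R ^ 2)⁻¹ * |y₂ - y₁|) atTop (𝓝 0) := by
    have h1 : Tendsto (fun R : ℝ => 1 + R ^ 2) atTop atTop :=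
      tendsto_atTop_add_const_left _ _ (tendsto_pow_atTop two_ne_zero)
    simpa using (h1.inv_tendsto_atTop.const_mul C).mul_const |y₂ - y₁|
  have hside : ∀ e : ℝ, |e| = 1 →
      Tendsto (fun R : ℝ => ∫ y in y₁..y₂, H ((e * R : ℝ) + y * I)) atTop (𝓝 0) := by
    intro e he
    refine squeeze_zero_norm' ?_ hlim
    filter_upwards [eventually_ge_atTop M, eventually_ge_atTop 0] with R hR hR0
    refine intervalIntegral.norm_integral_le_of_norm_le_const fun y hy => ?_
    have h2 : (e * R) ^ 2 = R ^ 2 := by rw [mul_pow, ← sq_abs e, he]; ring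
    have := hb (e * R) y (by rw [abs_mul, he, one_mul, abs_of_nonneg hR0]; exact hR)
      (uIoc_subset_uIcc hy)
    rwa [h2] at this
  have hrect : ∀ R : ℝ, (∫ a in (-R)..R, H (a + y₁ * I)) - (∫ a in (-R)..R, H (a + y₂ * I)) +
      I * (∫ y in y₁..y₂, H ((1 * R : ℝ) + y * I)) -
      I * (∫ y in y₁..y₂, H ((-1 * R : ℝ) + y * I)) = 0 := by
    intro R
    have := integral_boundary_rect_eq_zero_of_continuousOn_of_differentiableOn H
      (⟨-R, y₁⟩ : ℂ) ⟨R, y₂⟩ (hc.mono fun w hw => hw.2) (hd.mono fun w hw => hw.2)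
    simpa using this
  have hl := (((hline y₁ left_mem_uIcc).sub (hline y₂ right_mem_uIcc)).add
    ((hside 1 (by simp)).const_mul I)).sub ((hside (-1) (by simp)).const_mul I)
  simp only [hrect] at hl
  have := tendsto_nhds_unique hl tendsto_const_nhds
  simpa [sub_eq_zero] using this

/-- The substitution `v = e^a`. -/
theorem integral_Ioi_eq_integral_comp_exp (f : ℝ → ℂ) :
    ∫ v in Ioi (0 : ℝ), f v = ∫ a : ℝ, Real.exp a * f (Real.exp a) := by
  have h := integral_image_eq_integral_abs_deriv_smul (s := univ) (f := Real.exp)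
    (f' := Real.exp) MeasurableSet.univ
    (fun x _ => (Real.hasDerivAt_exp x).hasDerivWithinAt) Real.exp_injective.injOn f
  rw [image_univ, Real.range_exp] at h
  rw [h, setIntegral_univ]
  simp [abs_of_pos (Real.exp_pos _)]

/-! ### A uniform saddle point estimate -/

/-- The phase of the saddle point integrals, with its minimum `0` at `v = 1`. -/
noncomputable def phase (v : ℝ) : ℝ := (v ^ 2 - 1) / 2 - Real.log v

/-- From `log v ≤ v - 1`. The true coefficient at `v = 1` is `1`; the weaker `1/2` is valid
globally. -/
theorem sq_div_two_le_phase {v : ℝ} (hv : 0 < v) : (v - 1) ^ 2 / 2 ≤ phase v := by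
  have := Real.log_le_sub_one_of_pos hv
  unfold phase
  nlinarith

theorem abs_phase_sub_sq_le {v : ℝ} (hv : 1 / 2 ≤ v) :
    |phase v - (v - 1) ^ 2| ≤ 4 * |v - 1| ^ 3 := by
  rcases le_or_gt v (3 / 2) with h | h
  · have hx : |1 - v| ≤ 1 / 2 := abs_le.2 ⟨by linarith, by linarith⟩
    have key := Real.abs_log_sub_add_sum_range_le (x := 1 - v) (by linarith) 2
    have e : ∑ i ∈ Finset.range 2, (1 - v) ^ (i + 1) / ((i : ℝ) + 1) + Real.log (1 - (1 - v))
        = -(phase v - (v - 1) ^ 2) := by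
      simp only [Finset.sum_range_succ, Finset.sum_range_zero, sub_sub_cancel, phase]
      push_cast
      ring
    rw [e, abs_neg] at key
    refine key.trans ?_
    rw [div_le_iff₀ (by linarith), abs_sub_comm v 1]
    have : 0 ≤ |1 - v| ^ 3 := by positivity
    rw [show |1 - v| ^ (2 + 1) = |1 - v| ^ 3 from rfl]
    nlinarith
  · have h1 := Real.log_le_sub_one_of_pos (show 0 < v by linarith)
    have h2 := Real.log_nonneg (show 1 ≤ v by linarith)
    have hx : 1 / 2 ≤ v - 1 := by linarith
    rw [abs_of_pos (show 0 < v - 1 by linarith)]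
    have e : (v - 1) ≤ 4 * (v - 1) ^ 3 := by nlinarith [mul_nonneg (sub_nonneg.2 hx) (sub_nonneg.2 hx), sq_nonneg (v - 1)]
    have e2 : (v - 1) ^ 2 ≤ 2 * (v - 1) ^ 3 := by nlinarith [sq_nonneg (v - 1)]
    unfold phase
    rw [abs_le]
    constructor <;> nlinarith [sq_nonneg (v - 1)]

/-- Mean value inequality on the convex half-plane `Re ≤ m`, where the derivative of `exp` is at
most `e^m`. -/
theorem norm_exp_sub_exp_le {a b : ℂ} {m : ℝ} (ha : a.re ≤ m) (hb : b.re ≤ m) :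
    ‖exp a - exp b‖ ≤ ‖a - b‖ * Real.exp m := by
  have := (convex_halfSpace_re_le m).norm_image_sub_le_of_norm_deriv_le
    (f := exp) (C := Real.exp m) (fun x _ => differentiableAt_exp)
    (fun x hx => by
      rw [Complex.deriv_exp, norm_exp]
      exact Real.exp_le_exp.2 hx) (x := b) (y := a) hb ha
  rwa [mul_comm] at this

/-- Polynomial and exponential factors are absorbed by a Gaussian. -/
theorem poly_mul_exp_le {B δ z : ℝ} (hδ : 0 < δ) (hz : 0 ≤ z) :
    (1 + z + z ^ 3) * Real.exp (B * z) ≤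
      8 * Real.exp ((B + 1) ^ 2 / (4 * δ)) * Real.exp (δ * z ^ 2) := by
  have h1 : 1 + z + z ^ 3 ≤ 8 * Real.exp z := by
    have a1 := Real.add_one_le_exp z
    have a2 := Real.pow_div_factorial_le_exp z hz 3
    norm_num [Nat.factorial] at a2
    linarith
  calc (1 + z + z ^ 3) * Real.exp (B * z) ≤ 8 * Real.exp z * Real.exp (B * z) := by gcongr
    _ = 8 * Real.exp (z + B * z) := by rw [Real.exp_add]; ring
    _ ≤ 8 * Real.exp ((B + 1) ^ 2 / (4 * δ) + δ * z ^ 2) := by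
      refine mul_le_mul_of_nonneg_left (Real.exp_le_exp.2 ?_) (by norm_num)
      -- Completing the square bounds `(B + 1) z` by `δ z²` plus a constant.
      have : 0 ≤ ((B + 1) / (2 * δ) - z) ^ 2 * δ := by positivity
      have e : ((B + 1) / (2 * δ) - z) ^ 2 * δ
          = (B + 1) ^ 2 / (4 * δ) + δ * z ^ 2 - (z + B * z) := by field_simp; ring
      linarith
    _ = _ := by rw [Real.exp_add]; ring

theorem norm_exp_neg_mul_phase {τ : ℂ} (v : ℝ) :
    ‖exp (-τ * phase v)‖ = Real.exp (-(τ.re * phase v)) := by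
  rw [norm_exp]; simp

theorem norm_exp_quadratic_le (τ b : ℂ) (x : ℝ) :
    ‖exp (-τ * (x : ℂ) ^ 2 + b * x)‖ ≤ Real.exp (-(τ.re * x ^ 2)) * Real.exp (‖b‖ * |x|) := by
  rw [norm_exp, ← Real.exp_add]
  refine Real.exp_le_exp.2 ?_
  have h1 : (-τ * (x : ℂ) ^ 2 + b * x).re = -(τ.re * x ^ 2) + b.re * x := by
    rw [← ofReal_pow, add_re, re_mul_ofReal, re_mul_ofReal, neg_re]; ring
  have h2 : b.re * x ≤ ‖b‖ * |x| := (le_abs_self _).trans (by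
    rw [abs_mul]; gcongr; exact abs_re_le_norm b)
  linarith

section Pointwise

variable {c B T : ℝ} {τ b : ℂ} {g : ℝ → ℂ}

theorem sqrt_mul_abs_sq (hT : 0 ≤ T) (x : ℝ) : (√T * |x|) ^ 2 = T * x ^ 2 := by
  rw [mul_pow, Real.sq_sqrt hT, sq_abs]

/-- Away from the saddle, `1 ≤ 2|x| = 2 (√T |x|) / √T` gains the factor `T^{-1/2}` at the price of a
power of the scaled variable. -/
theorem norm_exp_quadratic_le_of_half_le (hT : 0 < T) (hre : c * T ≤ τ.re)
    (hb : ‖b‖ ≤ B * √T) {x : ℝ} (hx : 1 / 2 ≤ |x|) :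
    ‖exp (-τ * (x : ℂ) ^ 2 + b * x)‖ ≤
      (√T)⁻¹ * (2 * (√T * |x|) * Real.exp (B * (√T * |x|)) *
        Real.exp (-(c * (√T * |x|) ^ 2))) := by
  have hs : 0 < √T := Real.sqrt_pos.2 hT
  calc ‖exp (-τ * (x : ℂ) ^ 2 + b * x)‖
      ≤ Real.exp (-(τ.re * x ^ 2)) * Real.exp (‖b‖ * |x|) := norm_exp_quadratic_le _ _ _
    _ ≤ Real.exp (-(c * (√T * |x|) ^ 2)) * Real.exp (B * (√T * |x|)) := by
        rw [sqrt_mul_abs_sq hT.le]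
        refine mul_le_mul (Real.exp_le_exp.2 ?_) (Real.exp_le_exp.2 ?_) (by positivity)
          (by positivity)
        · nlinarith [sq_nonneg x]
        · nlinarith [abs_nonneg x]
    _ ≤ (2 * |x|) * (Real.exp (-(c * (√T * |x|) ^ 2)) * Real.exp (B * (√T * |x|))) :=
        le_mul_of_one_le_left (by positivity) (by linarith)
    _ = _ := by field_simp

/-- The pole of `g` and the factor `1/v` together give `v⁻²`, which equals `e^{2 phase v - (v² -
1)}`. Two units of `Re τ` absorb it, whence the condition `2 ≤ c * T`. -/
theorem norm_saddle_le_of_lt_half (hT : 0 < T) (hcT : 2 ≤ c * T)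
    (hre : c * T ≤ τ.re) (hb : ‖b‖ ≤ B * √T) (hB : 0 ≤ B) {v : ℝ} (hv : 0 < v) (hv' : v < 1 / 2)
    (hg : ‖g v‖ ≤ B / v * Real.exp (‖b‖ * |v - 1|)) :
    ‖exp (-τ * phase v) * (g v / v)‖ ≤
      (√T)⁻¹ * (2 * B * Real.exp 2 * (√T * |v - 1|) * Real.exp (B * (√T * |v - 1|)) *
        Real.exp (-(c * (√T * |v - 1|) ^ 2 / 2))) := by
  have hs : 0 < √T := Real.sqrt_pos.2 hT
  have hx : 1 / 2 ≤ |v - 1| := by rw [abs_of_neg (by linarith)]; linarith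
  have hp := sq_div_two_le_phase hv
  have hv2 : (v ^ 2)⁻¹ = Real.exp (-(2 * Real.log v)) := by
    rw [Real.exp_neg, two_mul, Real.exp_add, Real.exp_log hv, sq]
  have h1 : (v ^ 2)⁻¹ * Real.exp (-(τ.re * phase v)) ≤
      Real.exp 2 * Real.exp (-(c * (√T * |v - 1|) ^ 2 / 2)) := by
    rw [hv2, ← Real.exp_add, ← Real.exp_add, sqrt_mul_abs_sq hT.le]
    refine Real.exp_le_exp.2 ?_
    have e : -(2 * Real.log v) = 2 * phase v - (v ^ 2 - 1) := by unfold phase; ring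
    have h2 : (c * T - 2) * ((v - 1) ^ 2 / 2) ≤ (τ.re - 2) * phase v :=
      mul_le_mul (by linarith) hp (by positivity) (by linarith)
    have : (v - 1) ^ 2 ≤ 1 := by nlinarith
    rw [e]
    nlinarith [sq_nonneg v]
  have h3 : Real.exp (‖b‖ * |v - 1|) ≤ Real.exp (B * (√T * |v - 1|)) :=
    Real.exp_le_exp.2 (by nlinarith [abs_nonneg (v - 1)])
  calc ‖exp (-τ * phase v) * (g v / v)‖
      = Real.exp (-(τ.re * phase v)) * (‖g v‖ / v) := by
        rw [norm_mul, norm_exp_neg_mul_phase, norm_div, norm_real, Real.norm_of_nonneg hv.le]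
    _ ≤ Real.exp (-(τ.re * phase v)) * (B / v * Real.exp (B * (√T * |v - 1|)) / v) := by
        gcongr; exact hg.trans (by gcongr)
    _ = B * Real.exp (B * (√T * |v - 1|)) * ((v ^ 2)⁻¹ * Real.exp (-(τ.re * phase v))) := by
        field_simp
    _ ≤ B * Real.exp (B * (√T * |v - 1|)) *
        (Real.exp 2 * Real.exp (-(c * (√T * |v - 1|) ^ 2 / 2))) := by gcongr
    _ ≤ (2 * |v - 1|) * (B * Real.exp (B * (√T * |v - 1|)) *
        (Real.exp 2 * Real.exp (-(c * (√T * |v - 1|) ^ 2 / 2)))) :=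
        le_mul_of_one_le_left (by positivity) (by linarith)
    _ = _ := by field_simp

/-- Three replacements are made: `phase v` by `(v - 1)²`, `g` by its exponential, and `1/v` by `1`.
In terms of `z = √T |v - 1|` each costs `T^{-1/2}` times a polynomial in `z`; for the phase this is
`T |v - 1|³ = T^{-1/2} z³`. -/
theorem norm_saddle_sub_le_of_half_le (hc : 0 < c) (hT : 1 ≤ T) (hτ : ‖τ‖ = T)
    (hre : c * T ≤ τ.re) (hb : ‖b‖ ≤ B * √T) (hB : 0 ≤ B) {v : ℝ} (hv : 1 / 2 ≤ v)
    (hg : ‖g v - exp (b * (v - 1 : ℝ))‖ ≤ B / √T * Real.exp (‖b‖ * |v - 1|)) :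
    ‖exp (-τ * phase v) * (g v / v) - exp (-τ * ((v - 1 : ℝ) : ℂ) ^ 2 + b * (v - 1 : ℝ))‖ ≤
      (√T)⁻¹ * ((8 * (1 + B)) * (1 + √T * |v - 1| + (√T * |v - 1|) ^ 3) *
        Real.exp (B * (√T * |v - 1|)) * Real.exp (-(c * (√T * |v - 1|) ^ 2 / 2))) := by
  have hs : 0 < √T := Real.sqrt_pos.2 (by linarith)
  have hs1 : 1 ≤ √T := Real.one_le_sqrt.2 hT
  have hv0 : 0 < v := by linarith
  have hv0' : (v : ℂ) ≠ 0 := by exact_mod_cast hv0.ne'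
  have hp := sq_div_two_le_phase hv0
  have hvinv : v⁻¹ ≤ 2 := by rw [inv_le_comm₀ hv0 (by norm_num)]; linarith
  set z := √T * |v - 1| with hz
  have hz0 : 0 ≤ z := by positivity
  have hzsq : z ^ 2 = T * (v - 1) ^ 2 := sqrt_mul_abs_sq (by linarith) _
  have hxz : |v - 1| = (√T)⁻¹ * z := by rw [hz]; field_simp
  set E := Real.exp (B * z) with hE
  set F := Real.exp (-(c * z ^ 2 / 2)) with hF
  have hbz : Real.exp (‖b‖ * |v - 1|) ≤ E :=
    Real.exp_le_exp.2 (by rw [hz]; nlinarith [abs_nonneg (v - 1)])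
  have hcz : c * z ^ 2 ≤ τ.re * (v - 1) ^ 2 := by rw [hzsq]; nlinarith [sq_nonneg (v - 1)]
  have hczn : 0 ≤ c * z ^ 2 := by positivity
  have hq : Real.exp (-(τ.re * (v - 1) ^ 2)) ≤ F := Real.exp_le_exp.2 (by linarith)
  have hexpb : ‖exp (b * (v - 1 : ℝ))‖ ≤ E := by
    refine (norm_exp_le_exp_norm _).trans ?_
    rw [norm_mul, norm_real, Real.norm_eq_abs]; exact hbz
  have hgE : ‖g v‖ ≤ (1 + B) * E := by
    calc ‖g v‖ ≤ ‖g v - exp (b * (v - 1 : ℝ))‖ + ‖exp (b * (v - 1 : ℝ))‖ := by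
          simpa using norm_add_le (g v - exp (b * (v - 1 : ℝ))) (exp (b * (v - 1 : ℝ)))
      _ ≤ B / √T * E + E := by gcongr; exact hg.trans (by gcongr)
      _ ≤ B * E + E := by gcongr; exact div_le_self hB hs1
      _ = _ := by ring
  set Q := exp (-τ * ((v - 1 : ℝ) : ℂ) ^ 2) with hQ
  have hQF : ‖Q‖ ≤ F := by
    refine le_trans (le_of_eq ?_) hq
    rw [hQ, norm_exp, ← ofReal_pow, re_mul_ofReal, neg_re]; ring_nf
  have hdiff : ‖exp (-τ * phase v) - Q‖ ≤ (√T)⁻¹ * (4 * z ^ 3) * F := by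
    refine (norm_exp_sub_exp_le (m := -(c * z ^ 2 / 2)) ?_ ?_).trans ?_
    · rw [re_mul_ofReal, neg_re]
      have : τ.re * ((v - 1) ^ 2 / 2) ≤ τ.re * phase v :=
        mul_le_mul_of_nonneg_left hp (by nlinarith)
      linarith
    · rw [← ofReal_pow, re_mul_ofReal, neg_re]; linarith
    · gcongr
      have e : -τ * (phase v : ℂ) - -τ * ((v - 1 : ℝ) : ℂ) ^ 2
          = -τ * ((phase v - (v - 1) ^ 2 : ℝ) : ℂ) := by push_cast; ring
      rw [e, norm_mul, norm_neg, hτ, norm_real, Real.norm_eq_abs]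
      calc T * |phase v - (v - 1) ^ 2| ≤ T * (4 * |v - 1| ^ 3) := by
            gcongr; exact abs_phase_sub_sq_le hv
        _ = (√T) ^ 2 * (4 * |v - 1| ^ 3) := by rw [Real.sq_sqrt (by linarith)]
        _ = _ := by rw [hz]; field_simp
  have hinv : ‖(v : ℂ)⁻¹‖ ≤ 2 := by
    rw [norm_inv, norm_real, Real.norm_of_nonneg hv0.le]; exact hvinv
  have hone : ‖(v : ℂ)⁻¹ - 1‖ ≤ 2 * ((√T)⁻¹ * z) := by
    have e : (v : ℂ)⁻¹ - 1 = (v : ℂ)⁻¹ * ((1 - v : ℝ) : ℂ) := by push_cast; field_simp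
    rw [e, norm_mul, norm_real, Real.norm_eq_abs, abs_sub_comm, ← hxz]
    gcongr
  have split : exp (-τ * phase v) * (g v / v) - exp (-τ * ((v - 1 : ℝ) : ℂ) ^ 2 + b * (v - 1 : ℝ))
      = (exp (-τ * phase v) - Q) * g v * (v : ℂ)⁻¹
        + Q * (g v - exp (b * (v - 1 : ℝ))) * (v : ℂ)⁻¹
        + Q * exp (b * (v - 1 : ℝ)) * ((v : ℂ)⁻¹ - 1) := by
    rw [exp_add]; ring
  rw [split]
  calc _ ≤ ‖exp (-τ * phase v) - Q‖ * ‖g v‖ * ‖(v : ℂ)⁻¹‖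
        + ‖Q‖ * ‖g v - exp (b * (v - 1 : ℝ))‖ * ‖(v : ℂ)⁻¹‖
        + ‖Q‖ * ‖exp (b * (v - 1 : ℝ))‖ * ‖(v : ℂ)⁻¹ - 1‖ := by
        refine norm_add₃_le.trans (le_of_eq ?_)
        simp only [norm_mul]
    _ ≤ ((√T)⁻¹ * (4 * z ^ 3) * F) * ((1 + B) * E) * 2 + F * (B / √T * E) * 2
        + F * E * (2 * ((√T)⁻¹ * z)) := by
        have := hg.trans (mul_le_mul_of_nonneg_left hbz (by positivity : 0 ≤ B / √T))
        gcongr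
    _ = (√T)⁻¹ * ((8 * (1 + B) * z ^ 3 + 2 * B + 2 * z) * E * F) := by ring
    _ ≤ _ := by
        rw [show ∀ u : ℝ, u * E * F = u * (E * F) from fun u => by ring,
          show ∀ u : ℝ, u * E * F = u * (E * F) from fun u => by ring]
        gcongr
        nlinarith [mul_nonneg hB hz0]

end Pointwise

/-- The hypotheses of the saddle point estimate on the amplitude `g`: it is close to the
exponential `e^{b(v-1)}` for `v ≥ 1/2`, and has at most a simple pole at `0`. -/
structure IsAmplitude (B T : ℝ) (b : ℂ) (g : ℝ → ℂ) : Prop where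
  continuousOn : ContinuousOn g (Ioi 0)
  norm_le : ‖b‖ ≤ B * √T
  near : ∀ v, 1 / 2 ≤ v → ‖g v - exp (b * (v - 1 : ℝ))‖ ≤ B / √T * Real.exp (‖b‖ * |v - 1|)
  origin : ∀ v, 0 < v → v < 1 / 2 → ‖g v‖ ≤ B / v * Real.exp (‖b‖ * |v - 1|)

/-- Extending the integrand by zero to `v ≤ 0` allows comparison with a Gaussian on the whole line.
Half of the decay `e^{-cz²/2}` absorbs the polynomial and exponential factors; the other half
remains. -/
theorem norm_saddle_integrand_sub_gaussian_le {c B : ℝ} (hc : 0 < c) (hB : 0 ≤ B) :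
    ∃ C, 0 ≤ C ∧ ∀ (τ b : ℂ) (g : ℝ → ℂ), 1 ≤ ‖τ‖ → 2 ≤ c * ‖τ‖ → c * ‖τ‖ ≤ τ.re →
      IsAmplitude B ‖τ‖ b g → ∀ v : ℝ,
      ‖(Ioi (0 : ℝ)).indicator (fun v : ℝ => exp (-τ * phase v) * (g v / v)) v
        - exp (-τ * ((v - 1 : ℝ) : ℂ) ^ 2 + b * (v - 1 : ℝ))‖ ≤
        C * (√‖τ‖)⁻¹ * Real.exp (-(c * ‖τ‖ / 4) * (v - 1) ^ 2) := by
  set P := 8 * Real.exp ((B + 1) ^ 2 / (4 * (c / 4))) with hP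
  have hP0 : 0 ≤ P := by positivity
  refine ⟨(8 * (1 + B) + (2 * B * Real.exp 2 + 2)) * P, by positivity, ?_⟩
  intro τ b g hT hcT hre hg v
  set T := ‖τ‖ with hTdef
  have hT0 : 0 < T := by linarith
  set z := √T * |v - 1| with hz
  have hz0 : 0 ≤ z := by positivity
  have hzsq : z ^ 2 = T * (v - 1) ^ 2 := sqrt_mul_abs_sq hT0.le _
  have hF : Real.exp (-(c * T / 4) * (v - 1) ^ 2) = Real.exp (c / 4 * z ^ 2) *
      Real.exp (-(c * z ^ 2 / 2)) := by
    rw [← Real.exp_add, hzsq]; ring_nf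
  have habs : ∀ u, u ≤ 1 + z + z ^ 3 → u * Real.exp (B * z) * Real.exp (-(c * z ^ 2 / 2)) ≤
      P * Real.exp (-(c * T / 4) * (v - 1) ^ 2) := by
    intro u hu
    rw [hF, ← mul_assoc P]
    refine mul_le_mul_of_nonneg_right ?_ (Real.exp_pos _).le
    exact (mul_le_mul_of_nonneg_right hu (by positivity)).trans
      (poly_mul_exp_le (by positivity) hz0)
  have hz3 : z ≤ 1 + z + z ^ 3 := by have : 0 ≤ z ^ 3 := by positivity
                                     linarith
  have gauss : 1 / 2 ≤ |v - 1| → ‖exp (-τ * ((v - 1 : ℝ) : ℂ) ^ 2 + b * (v - 1 : ℝ))‖ ≤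
      2 * P * (√T)⁻¹ * Real.exp (-(c * T / 4) * (v - 1) ^ 2) := by
    intro hx
    refine (norm_exp_quadratic_le_of_half_le hT0 hre hg.norm_le hx).trans ?_
    rw [← hz]
    calc (√T)⁻¹ * (2 * z * Real.exp (B * z) * Real.exp (-(c * z ^ 2)))
        ≤ (√T)⁻¹ * (2 * z * Real.exp (B * z) * Real.exp (-(c * z ^ 2 / 2))) := by
          gcongr
          have : 0 ≤ c * z ^ 2 := by positivity
          linarith
      _ = 2 * (√T)⁻¹ * (z * Real.exp (B * z) * Real.exp (-(c * z ^ 2 / 2))) := by ring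
      _ ≤ 2 * (√T)⁻¹ * (P * Real.exp (-(c * T / 4) * (v - 1) ^ 2)) :=
          mul_le_mul_of_nonneg_left (habs z hz3) (by positivity)
      _ = _ := by ring
  have hW : 0 ≤ (√T)⁻¹ * Real.exp (-(c * T / 4) * (v - 1) ^ 2) := by positivity
  rcases le_or_gt v 0 with hv | hv
  · rw [indicator_of_notMem (by simpa using hv), zero_sub, norm_neg]
    refine (gauss (by rw [abs_of_neg (by linarith)]; linarith)).trans ?_
    gcongr
    have : 0 ≤ B * Real.exp 2 := by positivity
    linarith
  rw [indicator_of_mem (by simpa using hv)]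
  rcases lt_or_ge v (1 / 2) with hv' | hv'
  · have h1 := norm_saddle_le_of_lt_half hT0 hcT hre hg.norm_le hB hv hv' (hg.origin v hv hv')
    have h2 := gauss (by rw [abs_of_neg (by linarith)]; linarith)
    rw [← hz] at h1
    have h3 : (√T)⁻¹ * (2 * B * Real.exp 2 * z * Real.exp (B * z) * Real.exp (-(c * z ^ 2 / 2)))
        ≤ 2 * B * Real.exp 2 * (√T)⁻¹ * (P * Real.exp (-(c * T / 4) * (v - 1) ^ 2)) := by
      calc _ = 2 * B * Real.exp 2 * (√T)⁻¹ *
            (z * Real.exp (B * z) * Real.exp (-(c * z ^ 2 / 2))) := by ring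
        _ ≤ _ := mul_le_mul_of_nonneg_left (habs z hz3) (by positivity)
    refine (norm_sub_le _ _).trans ((add_le_add (h1.trans h3) h2).trans ?_)
    have : 0 ≤ (8 * (1 + B)) * P * ((√T)⁻¹ * Real.exp (-(c * T / 4) * (v - 1) ^ 2)) := by
      positivity
    linarith
  · refine (norm_saddle_sub_le_of_half_le hc hT rfl hre hg.norm_le hB hv' (hg.near v hv')).trans ?_
    rw [← hz]
    have h3 := mul_le_mul_of_nonneg_left (habs _ le_rfl)
      (by positivity : 0 ≤ 8 * (1 + B) * (√T)⁻¹)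
    have : 0 ≤ (2 * B * Real.exp 2 + 2) * P *
        ((√T)⁻¹ * Real.exp (-(c * T / 4) * (v - 1) ^ 2)) := by positivity
    linarith

/-- The saddle point method with explicit uniformity in the parameters. -/
theorem saddle_point_estimate {c B : ℝ} (hc : 0 < c) (hB : 0 ≤ B) :
    ∃ C, 0 ≤ C ∧ ∀ (τ b : ℂ) (g : ℝ → ℂ), 1 ≤ ‖τ‖ → 2 ≤ c * ‖τ‖ → c * ‖τ‖ ≤ τ.re →
      IsAmplitude B ‖τ‖ b g →
      ‖(∫ v in Ioi (0 : ℝ), exp (-τ * phase v) * (g v / v))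
        - (Real.pi / τ) ^ (1 / 2 : ℂ) * exp (b ^ 2 / (4 * τ))‖ ≤ C * ‖τ‖⁻¹ := by
  obtain ⟨C, hC, h⟩ := norm_saddle_integrand_sub_gaussian_le hc hB
  refine ⟨C * √(Real.pi / (c / 4)), by positivity, ?_⟩
  intro τ b g hT hcT hre hg
  have hT0 : 0 < ‖τ‖ := by linarith
  have hre0 : 0 < τ.re := by linarith
  have hpt := h τ b g hT hcT hre hg
  set f : ℝ → ℂ := fun v => exp (-τ * phase v) * (g v / v) with hf
  set q : ℝ → ℂ := fun v => exp (-τ * ((v - 1 : ℝ) : ℂ) ^ 2 + b * (v - 1 : ℝ)) with hq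
  set W : ℝ → ℝ := fun v => C * (√‖τ‖)⁻¹ * Real.exp (-(c * ‖τ‖ / 4) * (v - 1) ^ 2) with hW
  have hk : 0 < c * ‖τ‖ / 4 := by positivity
  have hWint : Integrable W :=
    ((integrable_exp_neg_mul_sq hk).comp_sub_right 1).const_mul _
  have hqint : Integrable q := by
    have := (integrable_cexp_quadratic hre0 b 0).comp_sub_right 1
    simpa [hq] using this
  have hfm : AEStronglyMeasurable ((Ioi (0 : ℝ)).indicator f) := by
    rw [aestronglyMeasurable_indicator_iff measurableSet_Ioi]
    refine ContinuousOn.aestronglyMeasurable ?_ measurableSet_Ioi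
    have hlog : ContinuousOn phase (Ioi 0) := by
      unfold phase
      exact (by fun_prop : Continuous fun v : ℝ => (v ^ 2 - 1) / 2).continuousOn.sub
        (Real.continuousOn_log.mono fun v hv => (ne_of_gt hv : v ≠ 0))
    refine ContinuousOn.mul ?_ (hg.continuousOn.div (by fun_prop) ?_)
    · exact continuous_exp.comp_continuousOn
        (continuousOn_const.mul (continuous_ofReal.comp_continuousOn hlog))
    · intro v hv
      exact_mod_cast (ne_of_gt hv : v ≠ 0)
  have hdint : Integrable fun v => (Ioi (0 : ℝ)).indicator f v - q v :=
    hWint.mono' (hfm.sub hqint.aestronglyMeasurable) (ae_of_all _ hpt)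
  have hfint : Integrable ((Ioi (0 : ℝ)).indicator f) := by
    have := hdint.add hqint
    simpa only [Pi.add_def, sub_add_cancel] using this
  have hqval : ∫ v, q v = (Real.pi / τ) ^ (1 / 2 : ℂ) * exp (b ^ 2 / (4 * τ)) := by
    have e := integral_sub_right_eq_self (fun x : ℝ => exp (-τ * (x : ℂ) ^ 2 + b * x + 0)) 1
      (μ := volume)
    have e2 := integral_cexp_quadratic (b := -τ) (by simpa using hre0) b 0
    rw [e2] at e
    simp only [add_zero] at e
    rw [hq, e, neg_neg]
    congr 2
    rw [zero_sub, mul_neg, div_neg, neg_neg]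
  rw [← hqval, ← integral_indicator measurableSet_Ioi, ← integral_sub hfint hqint]
  refine (norm_integral_le_of_norm_le hWint (ae_of_all _ hpt)).trans (le_of_eq ?_)
  rw [hW, integral_const_mul,
    integral_sub_right_eq_self (fun x : ℝ => Real.exp (-(c * ‖τ‖ / 4) * x ^ 2)) 1,
    integral_gaussian]
  -- The width of the Gaussian supplies the second factor `‖τ‖^{-1/2}`.
  have e : Real.pi / (c * ‖τ‖ / 4) = Real.pi / (c / 4) * ‖τ‖⁻¹ := by field_simp
  rw [e, Real.sqrt_mul (by positivity), Real.sqrt_inv]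
  have hss : (√‖τ‖)⁻¹ * (√‖τ‖)⁻¹ = ‖τ‖⁻¹ := by
    rw [← mul_inv, Real.mul_self_sqrt hT0.le]
  rw [← hss]; ring

/-! ### Rotation of rays, and `Γ` through its saddle point -/

/-- The bound that allows a rotation of the ray of integration, in the variable `a = log r`. -/
theorem exp_sub_mul_exp_le {p κ : ℝ} (hp : 1 ≤ p) (hκ : 0 < κ) (a : ℝ) :
    Real.exp (p * a - κ * Real.exp (2 * a)) ≤
      (2 * Real.exp ((p + 1) ^ 2 / (8 * κ))) * (1 + a ^ 2)⁻¹ := by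
  have h1 : p * a - κ * Real.exp (2 * a) ≤ (p + 1) ^ 2 / (8 * κ) - |a| := by
    rcases le_total a 0 with h | h
    · rw [abs_of_nonpos h]
      have : 0 ≤ (p + 1) ^ 2 / (8 * κ) := by positivity
      have : 0 ≤ κ * Real.exp (2 * a) := by positivity
      nlinarith
    · rw [abs_of_nonneg h]
      have h2 : 2 * a ^ 2 ≤ Real.exp (2 * a) := by
        have := Real.quadratic_le_exp_of_nonneg (x := 2 * a) (by linarith)
        nlinarith
      have h3 : 0 ≤ 2 * κ * (a - (p + 1) / (4 * κ)) ^ 2 := by positivity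
      have e : 2 * κ * (a - (p + 1) / (4 * κ)) ^ 2
          = (p + 1) ^ 2 / (8 * κ) + κ * (2 * a ^ 2) - (p + 1) * a := by field_simp; ring
      nlinarith [mul_le_mul_of_nonneg_left h2 hκ.le]
  have h2 : 1 + a ^ 2 ≤ 2 * Real.exp |a| := by
    have := Real.quadratic_le_exp_of_nonneg (abs_nonneg a)
    rw [sq_abs] at this
    nlinarith [abs_nonneg a, Real.one_le_exp (abs_nonneg a)]
  refine (Real.exp_le_exp.2 h1).trans ?_
  rw [← div_eq_mul_inv, le_div_iff₀ (by positivity), Real.exp_sub, div_mul_eq_mul_div,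
    div_le_iff₀ (Real.exp_pos _)]
  nlinarith [Real.exp_pos ((p + 1) ^ 2 / (8 * κ))]

/-- Rotation of a ray of integration, in the variable `w = log x`. -/
theorem integral_rotate {H : ℂ → ℂ} {y₁ p κ C : ℝ} {w₀ : ℂ} (hp : 1 ≤ p) (hκ : 0 < κ)
    (hC : 0 ≤ C) (hd : ∀ w : ℂ, w.im ∈ uIcc y₁ w₀.im → DifferentiableAt ℂ H w)
    (hb : ∀ w : ℂ, w.im ∈ uIcc y₁ w₀.im →
      ‖H w‖ ≤ C * Real.exp (p * w.re - κ * Real.exp (2 * w.re))) :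
    ∫ a : ℝ, H (a + y₁ * I) = ∫ a : ℝ, H (a + w₀) := by
  rw [integral_horizontal_line_eq (y₁ := y₁) (y₂ := w₀.im) (M := 0)
    (C := C * (2 * Real.exp ((p + 1) ^ 2 / (8 * κ))))
    (fun w hw => (hd w hw).continuousAt.continuousWithinAt)
    (fun w hw => (hd w (Ioo_subset_Icc_self hw)).differentiableWithinAt) ?_]
  -- Only the imaginary part of `w₀` moves the contour; its real part is a translation of `a`.
  · rw [← integral_add_right_eq_self (μ := volume) (fun a : ℝ => H (a + w₀.im * I)) w₀.re]
    congr 1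
    ext a
    rw [ofReal_add, add_assoc, re_add_im]
  · intro a y _ hy
    have := hb (a + y * I) (by simpa using hy)
    refine this.trans ?_
    rw [mul_assoc]
    gcongr
    simpa using exp_sub_mul_exp_le hp hκ a

theorem exp_half_log_sq {τ : ℂ} (h : τ ≠ 0) : exp (log τ / 2) ^ 2 = τ := by
  rw [← exp_nat_mul, Nat.cast_ofNat, mul_div_cancel₀ _ two_ne_zero, exp_log h]

theorem exp_re_sq_cis (w : ℂ) : (exp w ^ 2).re = Real.exp (2 * w.re) * Real.cos (2 * w.im) ∧
    (exp w ^ 2).im = Real.exp (2 * w.re) * Real.sin (2 * w.im) := by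
  rw [← exp_nat_mul, exp_re, exp_im]
  simp

/-- `Γ(τ)` as an integral along the ray through its saddle point. -/
theorem Gamma_eq_integral {τ : ℂ} (hτ : 1 ≤ τ.re) :
    Gamma τ = 2 * ∫ a : ℝ, exp (2 * τ * (a + log τ / 2) - τ * exp (2 * a)) := by
  have hτ0 : τ ≠ 0 := fun h => by simp [h] at hτ; linarith
  have hre : 0 < τ.re := by linarith
  set H : ℂ → ℂ := fun w => exp (2 * τ * w - exp w ^ 2) with hH
  have hcos : 0 < Real.cos τ.arg := Real.cos_pos_of_mem_Ioo
    (abs_lt.1 (abs_arg_lt_pi_div_two_iff.2 (Or.inl hre)))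
  have him : (log τ / 2).im = τ.arg / 2 := by
    rw [show (2 : ℂ) = ((2 : ℝ) : ℂ) by simp, div_ofReal_im, log_im]
  have h1 : Gamma τ = 2 * ∫ a : ℝ, H (a + (0 : ℝ) * I) := by
    -- Euler's integral under `t = r²`, then `r = e^a`.
    rw [Complex.Gamma_eq_integral hre, GammaIntegral, ← integral_comp_rpow_Ioi (p := 2) _ two_ne_zero,
      integral_Ioi_eq_integral_comp_exp, ← integral_const_mul]
    congr 1
    ext a
    have e1 : Real.exp a ^ (2 : ℝ) = Real.exp (2 * a) := by rw [← Real.exp_mul]; ring_nf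
    have e2 : Real.exp a ^ ((2 : ℝ) - 1) = Real.exp a := by norm_num
    rw [e1, e2, real_smul, cpow_def_of_ne_zero (by exact_mod_cast (Real.exp_pos _).ne'),
      ← ofReal_log (Real.exp_pos _).le, Real.log_exp, hH]
    simp only [ofReal_mul, ofReal_exp, ofReal_neg, abs_two, ofReal_ofNat, ofReal_zero, zero_mul,
      add_zero]
    rw [← exp_nat_mul (a : ℂ) 2, sub_eq_add_neg (2 * τ * (a : ℂ)), exp_add (2 * τ * (a : ℂ)),
      show 2 * τ * (a : ℂ) = a + a + 2 * a * (τ - 1) by ring, exp_add, exp_add]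
    push_cast
    ring
  rw [h1, integral_rotate (w₀ := log τ / 2) (p := 2 * τ.re) (κ := Real.cos τ.arg)
    (C := Real.exp (2 * |τ.im| * Real.pi)) (by linarith) hcos (Real.exp_pos _).le
    (fun w _ => by simp only [hH]; fun_prop)]
  · congr 2
    ext a
    rw [hH]
    simp only [exp_add, mul_pow, exp_half_log_sq hτ0]
    rw [← exp_nat_mul]
    congr 1
    push_cast
    ring
  · intro w hw
    rw [him] at hw
    have hy : |w.im| ≤ |τ.arg| / 2 := by
      rw [← abs_of_pos (zero_lt_two' ℝ), ← abs_div]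
      rcases mem_uIcc.1 hw with h | h
      · exact abs_le_abs_of_nonneg h.1 h.2
      · exact abs_le_abs_of_nonpos h.2 h.1
    rw [hH, norm_exp, ← Real.exp_add]
    refine Real.exp_le_exp.2 ?_
    rw [sub_re, (exp_re_sq_cis w).1]
    have e : (2 * τ * w).re = 2 * τ.re * w.re - 2 * τ.im * w.im := by simp
    -- Between the real axis and the ray through `√τ`, `|2 Im w| ≤ |arg τ| < π/2`, so `e^{-e^{2w}}`
    -- keeps decaying.
    have h3 : Real.cos τ.arg ≤ Real.cos (2 * w.im) := by
      rw [← Real.cos_abs, ← Real.cos_abs (2 * w.im)]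
      refine Real.cos_le_cos_of_nonneg_of_le_pi (abs_nonneg _) (abs_arg_le_pi τ) ?_
      rw [abs_mul, abs_two]; linarith only [hy]
    have h4 : -(2 * τ.im * w.im) ≤ 2 * |τ.im| * Real.pi := by
      refine (neg_le_abs _).trans ?_
      rw [abs_mul, abs_mul, abs_two]
      have := abs_arg_le_pi τ
      gcongr
      linarith [abs_nonneg τ.arg]
    have h5 := mul_le_mul_of_nonneg_left h3 (Real.exp_pos (2 * w.re)).le
    rw [e]
    linarith

/-! ### The integrand of `𝓡` and the line through the origin -/

/-- The reverse triangle inequality gives the lower bound `2 sinh (π |Im z|)`, and `sinh y ≥ y` for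
`y ≥ 0`. -/
theorem abs_im_le_norm_denominator (z : ℂ) :
    2 * Real.pi * |z.im| ≤ ‖exp (Real.pi * I * z) - exp (-(Real.pi * I * z))‖ := by
  have hre : (Real.pi * I * z).re = -(Real.pi * z.im) := by simp
  have key : ∀ y : ℝ, 0 ≤ y → 2 * y ≤ Real.exp y - Real.exp (-y) := fun y hy => by
    have := Real.self_le_sinh_iff.2 hy
    rw [Real.sinh_eq] at this
    linarith
  have h1 := norm_sub_norm_le (exp (Real.pi * I * z)) (exp (-(Real.pi * I * z)))
  have h2 := norm_sub_norm_le (exp (-(Real.pi * I * z))) (exp (Real.pi * I * z))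
  rw [norm_sub_rev] at h2
  rw [norm_exp, norm_exp, neg_re, hre, neg_neg] at h1 h2
  have hpi := Real.pi_pos
  rcases le_total 0 z.im with h | h
  · rw [abs_of_nonneg h]
    have := key (Real.pi * z.im) (by positivity)
    linarith
  · rw [abs_of_nonpos h]
    have := key (-(Real.pi * z.im)) (by nlinarith)
    rw [neg_neg] at this
    linarith

theorem denominator_eq_zero {z : ℂ} (h : exp (Real.pi * I * z) - exp (-(Real.pi * I * z)) = 0) :
    ∃ n : ℤ, z = n := by
  rw [sub_eq_zero, exp_eq_exp_iff_exists_int] at h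
  obtain ⟨n, hn⟩ := h
  refine ⟨n, ?_⟩
  have hpi : (Real.pi * I : ℂ) ≠ 0 := mul_ne_zero (by exact_mod_cast Real.pi_ne_zero) I_ne_zero
  apply mul_left_cancel₀ hpi
  linear_combination hn / 2

theorem differentiableAt_integrand (s : ℂ) {x : ℂ} (hx : x ∈ slitPlane)
    (h : exp (Real.pi * I * x) - exp (-(Real.pi * I * x)) ≠ 0) :
    DifferentiableAt ℂ (integrand s) x := by
  unfold integrand
  have h1 : DifferentiableAt ℂ (fun x : ℂ => x ^ (-s)) x :=
    (hasDerivAt_id x).cpow_const hx |>.differentiableAt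
  exact (h1.mul (by fun_prop)).div (by fun_prop) h

/-- The denominator vanishes at `0`, so this is the default value of division by zero. For `Re s <
-1` it is also the limit. -/
theorem integrand_zero {s : ℂ} : integrand s 0 = 0 := by
  simp [integrand]

/-- The denominator `D` has a simple zero at `0`. The integrand is `x^{-s-1} · e^{πix²} · (D x /
x)⁻¹`, whose first factor tends to `0` and whose other factors stay bounded. -/
theorem continuousAt_integrand_zero {s : ℂ} (hs : s.re < -1) : ContinuousAt (integrand s) 0 := by
  have hs1 : 0 < (-s - 1).re := by simp; linarith
  set D : ℂ → ℂ := fun x => exp (Real.pi * I * x) - exp (-(Real.pi * I * x)) with hD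
  have hDd : HasDerivAt D (2 * (Real.pi * I)) 0 := by
    have h1 : HasDerivAt (fun x : ℂ => Real.pi * I * x) (Real.pi * I) 0 := by
      simpa using (hasDerivAt_id (0 : ℂ)).const_mul (Real.pi * I)
    have := h1.cexp.sub h1.neg.cexp
    refine this.congr_deriv ?_
    simp only [Pi.neg_apply, mul_zero, neg_zero, exp_zero]
    ring
  have hpi : (2 * (Real.pi * I) : ℂ) ≠ 0 := by simp [Real.pi_ne_zero]
  have hslope : Tendsto (fun x => (D x / x)⁻¹) (𝓝[≠] 0) (𝓝 (2 * (Real.pi * I))⁻¹) := by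
    have := hDd.tendsto_slope
    refine (this.congr fun x => ?_).inv₀ hpi
    simp [slope, hD, div_eq_inv_mul]
  have hpow : Tendsto (fun x : ℂ => x ^ (-s - 1)) (𝓝[≠] 0) (𝓝 0) := by
    have h := (continuousAt_cpow_zero_of_re_pos hs1).comp (f := fun x : ℂ => (x, -s - 1)) (x := 0)
      (by fun_prop)
    have h2 := h.tendsto
    simp only [Function.comp_def] at h2
    rw [zero_cpow (fun h => by simp [h] at hs1)] at h2
    exact h2.mono_left nhdsWithin_le_nhds
  have hexp : Tendsto (fun x : ℂ => exp (Real.pi * I * x ^ 2)) (𝓝[≠] 0) (𝓝 1) := by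
    have : Continuous fun x : ℂ => exp (Real.pi * I * x ^ 2) := by fun_prop
    have h := this.tendsto 0
    simp only [ne_eq, OfNat.ofNat_ne_zero, not_false_eq_true, zero_pow, mul_zero, exp_zero] at h
    exact h.mono_left nhdsWithin_le_nhds
  rw [continuousAt_iff_punctured_nhds, integrand_zero]
  have := (hpow.mul hexp).mul hslope
  rw [zero_mul, zero_mul] at this
  refine this.congr' ?_
  filter_upwards [self_mem_nhdsWithin] with x hx
  have hx0 : x ≠ 0 := hx
  rw [cpow_sub _ _ hx0, cpow_one, integrand, inv_div]
  simp only [hD]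
  field_simp

theorem exp_pi_mul_I_div_four : exp (Real.pi * I / 4) = (√2 / 2 : ℝ) + (√2 / 2 : ℝ) * I := by
  rw [show (Real.pi * I / 4 : ℂ) = ((Real.pi / 4 : ℝ) : ℂ) * I by push_cast; ring, exp_mul_I,
    ← ofReal_cos, ← ofReal_sin, Real.cos_pi_div_four, Real.sin_pi_div_four]

/-- In the rotated coordinate `πix² = -πw²`. The conditions on `w` keep `|Im x| ≥ √2/2`, so the
denominator is at least `1`. -/
theorem norm_integrand_le (s : ℂ) {w : ℂ} (hre : 2 ≤ |w.re|) (him : |w.im| ≤ 1)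
    (hs : s.re ≤ 0) :
    ‖integrand s (exp (Real.pi * I / 4) * w)‖ ≤
      Real.exp (Real.pi * |s.im| + Real.pi + s.re ^ 2 / 4) * (1 + w.re ^ 2)⁻¹ := by
  set x := exp (Real.pi * I / 4) * w with hx
  have hpi := Real.pi_gt_three
  have hxim : x.im = √2 / 2 * (w.re + w.im) := by
    rw [hx, exp_pi_mul_I_div_four]; simp; ring
  have hnx : ‖x‖ = ‖w‖ := by
    rw [hx, norm_mul, show (Real.pi * I / 4 : ℂ) = ((Real.pi / 4 : ℝ) : ℂ) * I by push_cast; ring,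
      norm_exp_ofReal_mul_I, one_mul]
  have hsq : Real.pi * I * x ^ 2 = -(Real.pi * w ^ 2) := by
    have : exp (Real.pi * I / 4) ^ 2 = I := by
      rw [← exp_nat_mul, show ((2 : ℕ) : ℂ) * (Real.pi * I / 4) = Real.pi / 2 * I by push_cast; ring,
        exp_pi_div_two_mul_I]
    rw [hx, mul_pow, this]
    linear_combination Real.pi * w ^ 2 * I_sq
  have hden : 1 ≤ ‖exp (Real.pi * I * x) - exp (-(Real.pi * I * x))‖ := by
    refine le_trans ?_ (abs_im_le_norm_denominator x)
    have h1 : 1 ≤ |w.re + w.im| := by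
      have := abs_sub_abs_le_abs_add w.re w.im
      linarith
    have h2 : (1 : ℝ) ≤ √2 := Real.one_le_sqrt.2 (by norm_num)
    rw [hxim, abs_mul, abs_of_pos (by positivity)]
    nlinarith [mul_le_mul h2 h1 zero_le_one (by positivity : (0 : ℝ) ≤ √2)]
  have hpow : ‖x ^ (-s)‖ ≤ Real.exp (-s.re * |w.re|) * Real.exp (Real.pi * |s.im|) := by
    refine (norm_cpow_le _ _).trans ?_
    rw [div_eq_mul_inv, ← Real.exp_neg, hnx, neg_re, neg_im]
    refine mul_le_mul ?_ (Real.exp_le_exp.2 ?_) (Real.exp_pos _).le (Real.exp_pos _).le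
    · have hw : ‖w‖ ≤ Real.exp |w.re| := by
        have := norm_le_abs_re_add_abs_im w
        have := Real.add_one_le_exp |w.re|
        linarith
      rw [mul_comm, Real.exp_mul]
      exact Real.rpow_le_rpow (norm_nonneg _) hw (by linarith)
    · refine (le_abs_self _).trans ?_
      rw [abs_neg, abs_mul, abs_neg]
      gcongr
      exact abs_arg_le_pi x
  have hgauss : ‖exp (Real.pi * I * x ^ 2)‖ ≤ Real.exp (Real.pi - Real.pi * w.re ^ 2) := by
    rw [hsq, norm_exp]
    refine Real.exp_le_exp.2 ?_
    have : (-(Real.pi * w ^ 2 : ℂ)).re = -(Real.pi * (w.re ^ 2 - w.im ^ 2)) := by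
      rw [neg_re, re_ofReal_mul, sq, mul_re]; ring
    rw [this]
    have : w.im ^ 2 ≤ 1 := (sq_le_one_iff_abs_le_one _).2 him
    nlinarith
  have hfin : Real.exp (-w.re ^ 2) ≤ (1 + w.re ^ 2)⁻¹ := by
    rw [Real.exp_neg]
    gcongr
    linarith [Real.add_one_le_exp (w.re ^ 2)]
  rw [integrand, norm_div, norm_mul]
  calc _ ≤ ‖x ^ (-s)‖ * ‖exp (Real.pi * I * x ^ 2)‖ := div_le_self (by positivity) hden
    _ ≤ Real.exp (-s.re * |w.re|) * Real.exp (Real.pi * |s.im|) *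
        Real.exp (Real.pi - Real.pi * w.re ^ 2) := by gcongr
    _ ≤ Real.exp (Real.pi * |s.im| + Real.pi + s.re ^ 2 / 4) * Real.exp (-w.re ^ 2) := by
      rw [← Real.exp_add, ← Real.exp_add, ← Real.exp_add]
      refine Real.exp_le_exp.2 ?_
      -- `-σ|a| ≤ σ²/4 + a²`, and `π > 2` leaves `e^{-a²}` over.
      nlinarith [sq_nonneg (-s.re / 2 - |w.re|), sq_abs w.re, sq_nonneg w.re]
    _ ≤ _ := by gcongr

/-- The strip between the line `0 ↙ 1` and the parallel line through `0` meets neither the cut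
nor, except at `0`, the poles of the integrand. -/
theorem differentiableAt_integrand_of_strip (s : ℂ) {w : ℂ} (hw : w.im ∈ Icc (-(√2 / 2) / 2) 0)
    (hw0 : w ≠ 0) : DifferentiableAt ℂ (integrand s) (exp (Real.pi * I / 4) * w) := by
  set ω := exp (Real.pi * I / 4) with hω
  have hω' := exp_pi_mul_I_div_four
  rw [← hω] at hω'
  have hr2 : (√2 / 2) ^ 2 = (1 / 2 : ℝ) := by rw [div_pow, Real.sq_sqrt (by norm_num)]; norm_num
  set r := √2 / 2 with hr
  have hr0 : 0 < r := by rw [hr]; positivity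
  have hre : (ω * w).re = r * (w.re - w.im) := by rw [hω']; simp; ring
  have him : (ω * w).im = r * (w.re + w.im) := by rw [hω']; simp; ring
  refine differentiableAt_integrand s ?_ fun h => ?_
  · rw [mem_slitPlane_iff, hre, him]
    by_contra hcon
    push Not at hcon
    have e1 : w.re + w.im = 0 := by
      rcases mul_eq_zero.1 hcon.2 with h | h
      · exact absurd h hr0.ne'
      · exact h
    have e2 : w.re - w.im ≤ 0 := by
      by_contra h
      exact absurd hcon.1 (not_le.2 (mul_pos hr0 (not_le.1 h)))
    have e3 := hw.2
    exact hw0 (Complex.ext (by simp; linarith) (by simp; linarith))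
  · obtain ⟨n, hn⟩ := denominator_eq_zero h
    rw [hn, intCast_re] at hre
    rw [hn, intCast_im] at him
    have e1 : w.re + w.im = 0 := by
      rcases mul_eq_zero.1 him.symm with h | h
      · exact absurd h hr0.ne'
      · exact h
    have e2 : (n : ℝ) = -(2 * r * w.im) := by rw [hre]; linear_combination r * e1
    have e3 : (0 : ℝ) ≤ n := by rw [e2]; nlinarith [hw.2]
    have e4 : (n : ℝ) < 1 := by rw [e2]; nlinarith [hw.1]
    have e5 : n = 0 := by
      have : (0 : ℤ) ≤ n := by exact_mod_cast e3
      have : n < 1 := by exact_mod_cast e4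
      omega
    rw [e5, Int.cast_zero] at hn
    rcases mul_eq_zero.1 hn with h | h
    · exact exp_ne_zero _ h
    · exact hw0 h

theorem continuousAt_integrand_of_strip {s : ℂ} (hs : s.re < -1) {w : ℂ}
    (hw : w.im ∈ Icc (-(√2 / 2) / 2) 0) :
    ContinuousAt (integrand s) (exp (Real.pi * I / 4) * w) := by
  by_cases h0 : w = 0
  · rw [h0, mul_zero]
    exact continuousAt_integrand_zero hs
  · exact (differentiableAt_integrand_of_strip s hw h0).continuousAt

theorem integrable_integrand_line {s : ℂ} (hs : s.re < -1) :
    Integrable fun a : ℝ => integrand s (exp (Real.pi * I / 4) * a) := by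
  refine (integrable_horizontal_line (H := fun w => integrand s (exp (Real.pi * I / 4) * w))
    (y := 0) (M := 2) (C := Real.exp (Real.pi * |s.im| + Real.pi + s.re ^ 2 / 4))
    ?_ ?_).congr ?_
  · refine continuous_iff_continuousAt.2 fun a => ?_
    have hs2 : 0 ≤ √2 := Real.sqrt_nonneg _
    exact ContinuousAt.comp (g := integrand s)
      (f := fun a : ℝ => exp (Real.pi * I / 4) * ((a : ℂ) + ((0 : ℝ) : ℂ) * I))
      (continuousAt_integrand_of_strip hs (by simp; linarith)) (by fun_prop)
  · intro a ha
    simpa using norm_integrand_le s (w := a + (0 : ℝ) * I) (by simpa using ha) (by simp)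
      (by linarith)
  · exact ae_of_all _ fun a => by simp

/-- The line `0 ↙ 1` can be moved to the line of the same direction through `0`. -/
theorem auxR_eq_integral_line {s : ℂ} (hs : s.re < -1) :
    auxR s = -(exp (Real.pi * I / 4) * ∫ a : ℝ, integrand s (exp (Real.pi * I / 4) * a)) := by
  set ω := exp (Real.pi * I / 4) with hω
  have hω' := exp_pi_mul_I_div_four
  rw [← hω] at hω'
  have hr2 : (√2 / 2) ^ 2 = (1 / 2 : ℝ) := by rw [div_pow, Real.sq_sqrt (by norm_num)]; norm_num
  set r := √2 / 2 with hr
  have hr0 : 0 < r := by rw [hr]; positivity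
  have hr1 : r ≤ 1 := by nlinarith
  have hneg : exp (-(3 * Real.pi * I / 4)) = -ω := by
    rw [show -(3 * Real.pi * I / 4 : ℂ) = Real.pi * I / 4 - Real.pi * I by ring, exp_sub, exp_pi_mul_I]
    simp [hω, div_neg]
  -- Since `1/2 = ω (r/2 - ir/2)`, the line has height `-r/2` in the coordinate `w`. Its direction
  -- `-ω` explains the sign and the reflection `a ↦ -a`.
  have h1 : auxR s = -(ω * ∫ a : ℝ, integrand s (ω * (a + ((-r / 2 : ℝ) : ℂ) * I))) := by
    rw [← integral_add_right_eq_self _ (r / 2), ← integral_neg_eq_self, ← integral_const_mul,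
      ← integral_neg, auxR]
    congr 1
    ext u
    have : path u = ω * (((-u + r / 2 : ℝ) : ℂ) + ((-r / 2 : ℝ) : ℂ) * I) := by
      have hr2' : (r : ℂ) ^ 2 = 1 / 2 := by rw [← ofReal_pow, hr2]; simp
      rw [path, hneg, hω']
      push_cast
      linear_combination (-1 : ℂ) * hr2' + (r : ℂ) ^ 2 / 2 * I_sq
    rw [hneg, this]
    ring
  have hu : uIcc (-r / 2) 0 = Icc (-r / 2) 0 := uIcc_of_le (by linarith)
  rw [h1, integral_horizontal_line_eq (H := fun w => integrand s (ω * w)) (y₂ := 0) (M := 2)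
    (C := Real.exp (Real.pi * |s.im| + Real.pi + s.re ^ 2 / 4)) ?_ ?_ ?_]
  · simp
  · intro w hw
    have hlin : ContinuousAt (fun w => ω * w) w := by fun_prop
    refine ContinuousAt.continuousWithinAt ?_
    exact ContinuousAt.comp (g := integrand s)
      (continuousAt_integrand_of_strip hs (hu ▸ hw)) hlin
  · intro w hw
    rw [mem_ofPred_eq, min_eq_left (by linarith), max_eq_right (by linarith)] at hw
    have h0 : w ≠ 0 := fun h => by simp [h] at hw
    refine DifferentiableAt.differentiableWithinAt ?_
    exact DifferentiableAt.comp (g := integrand s) w 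
      (differentiableAt_integrand_of_strip s (Ioo_subset_Icc_self hw) h0) (by fun_prop)
  · intro a y ha hy
    rw [hu] at hy
    have := norm_integrand_le s (w := a + y * I) (by simpa using ha)
      (by simpa using abs_le.2 ⟨by linarith [hy.1], by linarith [hy.2]⟩) (by linarith)
    simpa using this

/-! ### The ray integral and its rotation to `η` -/

/-- The integrand of `𝓡(1 - τ)` times `dx/dw`, in the variable `w = log x`. -/
noncomputable def rayIntegrand (τ w : ℂ) : ℂ :=
  exp (τ * w) * exp (Real.pi * I * exp w ^ 2) /
    (exp (Real.pi * I * exp w) - exp (-(Real.pi * I * exp w)))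

theorem integrand_exp (s : ℂ) {w : ℂ} (h1 : -Real.pi < w.im) (h2 : w.im ≤ Real.pi) :
    exp w * integrand s (exp w) = rayIntegrand (1 - s) w := by
  rw [integrand, rayIntegrand, cpow_def_of_ne_zero (exp_ne_zero w), log_exp h1 h2,
    show (1 - s) * w = w + w * -s by ring, exp_add]
  ring

/-- For `Im x > 0` the principal logarithm satisfies `log (-x) = log x - πi`, so `(-x)^{-s} =
e^{πis} x^{-s}`, while the denominator is odd. The lower half-line is therefore a multiple of the
upper one. -/
theorem auxR_eq_integral_ray {s : ℂ} (hs : s.re < -1) :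
    auxR s = (exp (Real.pi * I * s) - 1) *
      ∫ a : ℝ, rayIntegrand (1 - s) (a + (Real.pi / 4 : ℝ) * I) := by
  have hpi := Real.pi_pos
  set ω := exp (Real.pi * I / 4) with hω
  have hint := integrable_integrand_line hs
  rw [← hω] at hint
  have hexp : ∀ a : ℝ, exp (a + (Real.pi / 4 : ℝ) * I) = ω * (Real.exp a : ℝ) := fun a => by
    rw [exp_add, ← ofReal_exp, mul_comm, hω]
    congr 2; push_cast; ring
  have hneg : ∀ x : ℂ, 0 < x.im → integrand s (-x) = -(exp (Real.pi * I * s) * integrand s x) := by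
    intro x hx
    have hx0 : x ≠ 0 := fun h => by simp [h] at hx
    have hlog : log (-x) = log x - Real.pi * I := by
      rw [log, log, norm_neg, arg_neg_eq_arg_sub_pi_of_im_pos hx]; push_cast; ring
    rw [integrand, integrand, cpow_def_of_ne_zero (neg_ne_zero.2 hx0), cpow_def_of_ne_zero hx0, hlog,
      show (log x - Real.pi * I) * -s = Real.pi * I * s + log x * -s by ring, exp_add, neg_sq,
      mul_neg (Real.pi * I : ℂ) x, neg_neg (Real.pi * I * x), ← neg_sub (exp (Real.pi * I * x)), div_neg]
    ring
  have hpos : ∫ a in Ioi (0 : ℝ), ω * integrand s (ω * a) =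
      ∫ a : ℝ, rayIntegrand (1 - s) (a + (Real.pi / 4 : ℝ) * I) := by
    rw [integral_Ioi_eq_integral_comp_exp]
    congr 1
    ext a
    rw [← integrand_exp s (by simp; linarith) (by simp; linarith), hexp a]
    ring
  have hnegpart : ∫ a in Iic (0 : ℝ), ω * integrand s (ω * a) =
      -(exp (Real.pi * I * s) * ∫ a in Ioi (0 : ℝ), ω * integrand s (ω * a)) := by
    have h := integral_comp_neg_Ioi (0 : ℝ) (fun a : ℝ => ω * integrand s (ω * a))
    rw [neg_zero] at h
    rw [← h, ← integral_const_mul, ← integral_neg]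
    refine setIntegral_congr_fun measurableSet_Ioi fun a ha => ?_
    have ha : 0 < a := ha
    have him : 0 < (ω * a).im := by
      rw [hω, exp_pi_mul_I_div_four]; simpa using ha
    simp only [ofReal_neg, mul_neg, hneg _ him]
    ring
  rw [auxR_eq_integral_line hs, ← hω, ← integral_const_mul,
    ← intervalIntegral.integral_Iic_add_Ioi (hint.const_mul ω).integrableOn
      (hint.const_mul ω).integrableOn (b := 0), hnegpart, hpos]
  ring

/-- The logarithm of the saddle point `η` in terms of `τ = 1 - s`. -/
noncomputable def logEta (τ : ℂ) : ℂ := Real.pi * I / 4 + log (τ / (2 * Real.pi)) / 2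

theorem logEta_im (τ : ℂ) : (logEta τ).im = Real.pi / 4 + τ.arg / 2 := by
  have h : τ / (2 * Real.pi) = (((2 * Real.pi)⁻¹ : ℝ) : ℂ) * τ := by
    push_cast; rw [div_eq_inv_mul]
  have h1 : (Real.pi * I / 4 : ℂ) = ((Real.pi / 4 : ℝ) : ℂ) * I := by push_cast; ring
  rw [logEta, add_im, h1, h, show (2 : ℂ) = ((2 : ℝ) : ℂ) by simp, div_ofReal_im, log_im,
    arg_real_mul _ (by have := Real.pi_pos; positivity)]
  simp

theorem exp_logEta {s : ℂ} (hs : 1 - s ≠ 0) : exp (logEta (1 - s)) = eta s := by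
  have h : (1 - s) / (2 * Real.pi) ≠ 0 := by simp [hs, Real.pi_ne_zero]
  rw [logEta, exp_add, eta, cpow_def_of_ne_zero h]
  ring_nf

theorem exp_logEta_sq {τ : ℂ} (hτ : τ ≠ 0) : exp (logEta τ) ^ 2 = I * τ / (2 * Real.pi) := by
  have h : τ / (2 * Real.pi) ≠ 0 := by simp [hτ, Real.pi_ne_zero]
  rw [logEta, exp_add, mul_pow, exp_half_log_sq h, ← exp_nat_mul,
    show ((2 : ℕ) : ℂ) * (Real.pi * I / 4) = Real.pi / 2 * I by push_cast; ring,
    exp_pi_div_two_mul_I]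
  ring

/-- Within angle `δ` of the diagonal, `Im e^w ≥ e^{Re w} sin (π/4 - δ)` bounds the denominator below
and lowers the exponent to `Re τ - 1`. The Gaussian decays because `sin (2 Im w) ≥ cos 2δ`. -/
theorem norm_rayIntegrand_le {τ w : ℂ} {δ : ℝ} (hδ : δ < Real.pi / 4)
    (hw : |w.im - Real.pi / 4| ≤ δ) :
    ‖rayIntegrand τ w‖ ≤ Real.exp (|τ.im| * Real.pi) / (2 * Real.pi * Real.sin (Real.pi / 4 - δ)) *
      Real.exp ((τ.re - 1) * w.re - Real.pi * Real.cos (2 * δ) * Real.exp (2 * w.re)) := by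
  have hpi := Real.pi_pos
  have hδ0 := (abs_nonneg _).trans hw
  have hw' := abs_le.1 hw
  have hsin0 : 0 < Real.sin (Real.pi / 4 - δ) :=
    Real.sin_pos_of_pos_of_lt_pi (by linarith) (by linarith)
  have hsin : Real.sin (Real.pi / 4 - δ) ≤ Real.sin w.im :=
    Real.sin_le_sin_of_le_of_le_pi_div_two (by linarith) (by linarith) (by linarith)
  have hcos : Real.cos (2 * δ) ≤ Real.sin (2 * w.im) := by
    rw [← Real.cos_sub_pi_div_two, ← Real.cos_abs (2 * w.im - Real.pi / 2)]
    refine Real.cos_le_cos_of_nonneg_of_le_pi (abs_nonneg _) (by linarith) ?_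
    rw [show 2 * w.im - Real.pi / 2 = 2 * (w.im - Real.pi / 4) by ring, abs_mul, abs_two]
    linarith
  have hden : Real.exp w.re * (2 * Real.pi * Real.sin (Real.pi / 4 - δ)) ≤
      ‖exp (Real.pi * I * exp w) - exp (-(Real.pi * I * exp w))‖ := by
    refine le_trans ?_ (abs_im_le_norm_denominator _)
    rw [exp_im, abs_of_pos (mul_pos (Real.exp_pos _) (hsin0.trans_le hsin))]
    have := mul_le_mul_of_nonneg_left hsin (Real.exp_pos w.re).le
    nlinarith
  have h1 : ‖exp (τ * w)‖ ≤ Real.exp (|τ.im| * Real.pi) * Real.exp (τ.re * w.re) := by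
    rw [norm_exp, ← Real.exp_add, mul_re]
    refine Real.exp_le_exp.2 ?_
    have : -(τ.im * w.im) ≤ |τ.im| * Real.pi := by
      refine (neg_le_abs _).trans ?_
      rw [abs_mul]
      gcongr
      exact abs_le.2 ⟨by linarith, by linarith⟩
    linarith
  have h2 : ‖exp (Real.pi * I * exp w ^ 2)‖ ≤
      Real.exp (-(Real.pi * Real.cos (2 * δ) * Real.exp (2 * w.re))) := by
    rw [norm_exp]
    refine Real.exp_le_exp.2 ?_
    have : (Real.pi * I * exp w ^ 2).re = -(Real.pi * (exp w ^ 2).im) := by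
      rw [mul_assoc, re_ofReal_mul, I_mul_re]; ring
    rw [this, (exp_re_sq_cis w).2]
    have := mul_le_mul_of_nonneg_left hcos (Real.exp_pos (2 * w.re)).le
    nlinarith
  rw [rayIntegrand, norm_div, norm_mul, div_le_iff₀ (lt_of_lt_of_le (by positivity) hden)]
  calc _ ≤ Real.exp (|τ.im| * Real.pi) * Real.exp (τ.re * w.re) *
        Real.exp (-(Real.pi * Real.cos (2 * δ) * Real.exp (2 * w.re))) := by gcongr
    _ = Real.exp (|τ.im| * Real.pi) / (2 * Real.pi * Real.sin (Real.pi / 4 - δ)) *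
      Real.exp ((τ.re - 1) * w.re - Real.pi * Real.cos (2 * δ) * Real.exp (2 * w.re)) *
      (Real.exp w.re * (2 * Real.pi * Real.sin (Real.pi / 4 - δ))) := by
        rw [sub_eq_add_neg ((τ.re - 1) * w.re), Real.exp_add,
          show τ.re * w.re = (τ.re - 1) * w.re + w.re by ring, Real.exp_add]
        generalize Real.sin (Real.pi / 4 - δ) = S at hsin0
        field_simp
    _ ≤ _ := by gcongr

/-- As `arg η = π/4 + arg τ / 2`, the rotation stays within `|arg τ| / 2 < π/4` of the diagonal, off
the poles. `Re τ ≥ 2` gives the exponent `p ≥ 1` that `integral_rotate` needs. -/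
theorem integral_rayIntegrand_rotate {τ : ℂ} (hτ : 2 ≤ τ.re) :
    ∫ a : ℝ, rayIntegrand τ (a + (Real.pi / 4 : ℝ) * I) =
      ∫ a : ℝ, rayIntegrand τ (a + logEta τ) := by
  have hpi := Real.pi_pos
  have harg := abs_arg_lt_pi_div_two_iff.2 (Or.inl (show 0 < τ.re by linarith))
  have hcos : 0 < Real.cos (2 * (|τ.arg| / 2)) :=
    Real.cos_pos_of_mem_Ioo ⟨by linarith [abs_nonneg τ.arg], by linarith⟩
  have hsin : 0 < Real.sin (Real.pi / 4 - |τ.arg| / 2) :=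
    Real.sin_pos_of_pos_of_lt_pi (by linarith) (by linarith [abs_nonneg τ.arg])
  have hy : ∀ w : ℂ, w.im ∈ uIcc (Real.pi / 4) (logEta τ).im →
      |w.im - Real.pi / 4| ≤ |τ.arg| / 2 := by
    intro w hw
    have := abs_sub_left_of_mem_uIcc hw
    rwa [logEta_im, add_sub_cancel_left, abs_div, abs_two] at this
  refine integral_rotate (p := τ.re - 1) (by linarith) (mul_pos hpi hcos)
    (by positivity) (fun w hw => ?_)
    (fun w hw => norm_rayIntegrand_le (by linarith) (hy w hw))
  have hw' := abs_le.1 (hy w hw)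
  unfold rayIntegrand
  refine DifferentiableAt.div (by fun_prop) (by fun_prop) fun h => ?_
  have h1 := abs_im_le_norm_denominator (exp w)
  rw [h, norm_zero, exp_im, abs_of_pos (mul_pos (Real.exp_pos _)
    (Real.sin_pos_of_pos_of_lt_pi (by linarith) (by linarith)))] at h1
  have := mul_pos (Real.exp_pos w.re)
    (Real.sin_pos_of_pos_of_lt_pi (x := w.im) (by linarith) (by linarith))
  nlinarith

/-! ### Both integrals in saddle point form -/

theorem cexp_neg_mul_phase_exp (τ : ℂ) (a : ℝ) :
    exp (-τ * phase (Real.exp a)) = exp (τ * a - τ * exp (2 * a) / 2 + τ / 2) := by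
  rw [phase, Real.log_exp, ← Real.exp_nat_mul]
  push_cast
  ring_nf

theorem Gamma_eq_saddle {τ : ℂ} (hτ : 1 ≤ τ.re) :
    Gamma τ = exp (τ * log τ - τ) *
      (2 * ∫ v in Ioi (0 : ℝ), exp (-(2 * τ) * phase v) * (1 / v)) := by
  rw [Gamma_eq_integral hτ, integral_Ioi_eq_integral_comp_exp, mul_left_comm,
    ← integral_const_mul (exp _)]
  congr 2
  ext a
  have h : ((Real.exp a : ℝ) : ℂ) ≠ 0 := by exact_mod_cast (Real.exp_pos a).ne'
  have e : ∀ A B : ℂ, A * ((Real.exp a : ℝ) * (B * (1 / (Real.exp a : ℝ)))) = A * B :=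
    fun A B => by field_simp
  rw [cexp_neg_mul_phase_exp, e, ← exp_add]
  ring_nf

/-- The amplitude of the saddle point integral for `𝓡`, where `b = πiη`. -/
noncomputable def amplitude (b : ℂ) (v : ℝ) : ℂ := exp (b * (v - 1 : ℝ)) / (1 - exp (2 * b * v))

/-- Substitute `x = ηv` and use `πiη² = -τ/2`. The factor `e^b` is extracted so that the numerator
of the amplitude is `1` at the saddle `v = 1`. -/
theorem integral_rayIntegrand_eq_saddle {τ : ℂ} (hτ : τ ≠ 0) :
    ∫ a : ℝ, rayIntegrand τ (a + logEta τ) =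
      -(exp (τ * logEta τ - τ / 2 + Real.pi * I * exp (logEta τ)) *
        ∫ v in Ioi (0 : ℝ), exp (-τ * phase v) *
          (amplitude (Real.pi * I * exp (logEta τ)) v / v)) := by
  rw [integral_Ioi_eq_integral_comp_exp, ← integral_const_mul, ← integral_neg]
  congr 1
  ext a
  have h : ((Real.exp a : ℝ) : ℂ) ≠ 0 := by exact_mod_cast (Real.exp_pos a).ne'
  set b := Real.pi * I * exp (logEta τ) with hb
  have hpi : (Real.pi : ℂ) ≠ 0 := by exact_mod_cast Real.pi_ne_zero
  have e1 : Real.pi * I * exp (a + logEta τ) = b * Real.exp a := by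
    rw [exp_add, hb]; push_cast; ring
  have e2 : Real.pi * I * exp (a + logEta τ) ^ 2 = -(τ * exp (2 * a) / 2) := by
    rw [exp_add, mul_pow, exp_logEta_sq hτ, ← exp_nat_mul]
    push_cast
    field_simp
    linear_combination I_sq
  have e3 : ((Real.exp a : ℝ) : ℂ) * (exp (-τ * phase (Real.exp a)) *
      (amplitude b (Real.exp a) / (Real.exp a : ℝ))) =
      exp (-τ * phase (Real.exp a)) * amplitude b (Real.exp a) := by field_simp
  rw [e3, rayIntegrand, e1, e2, cexp_neg_mul_phase_exp, amplitude]
  set E := exp (b * Real.exp a) with hE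
  have hE0 : E ≠ 0 := exp_ne_zero _
  have e4 : exp (2 * b * Real.exp a) = E ^ 2 := by
    rw [hE, ← exp_nat_mul]; push_cast; ring_nf
  have e5 : E - exp (-(b * Real.exp a)) = -((1 - E ^ 2) / E) := by
    rw [exp_neg, ← hE]; field_simp; ring
  have e6 : exp (b * (Real.exp a - 1 : ℝ)) = E * exp (-b) := by
    rw [hE, ← exp_add]; push_cast; ring_nf
  rw [e5, e4, e6, div_neg, div_div_eq_mul_div]
  have e7 : exp (τ * (a + logEta τ)) * exp (-(τ * exp (2 * a) / 2)) =
      exp (τ * logEta τ - τ / 2 + b) * (exp (τ * a - τ * exp (2 * a) / 2 + τ / 2) * exp (-b)) := by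
    simp only [← exp_add]
    ring_nf
  rw [e7]
  ring

theorem isAmplitude_one {B T : ℝ} (hB : 1 ≤ B) : IsAmplitude B T 0 fun _ => 1 where
  continuousOn := continuousOn_const
  norm_le := by rw [norm_zero]; positivity
  near v _ := by
    simp only [zero_mul, exp_zero, sub_self, norm_zero]; positivity
  origin v hv hv' := by
    simp only [norm_one, norm_zero, zero_mul, Real.exp_zero, mul_one]
    rw [le_div_iff₀ hv]; linarith

/-- Everything rests on `|e^{2bv}| = e^{2 Re b · v}`. For `v ≥ 1/2` the relative error `q / (1 -
q)`, `q = e^{2bv}`, is at most `1 / (-Re b)` in norm. For `v < 1/2`, `|1 - q| ≥ 1 - e^{-2v} ≥ v`. -/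
theorem isAmplitude_amplitude {B T : ℝ} {b : ℂ} (hB : 1 ≤ B) (hT : 0 < T) (h1 : b.re ≤ -1)
    (hb : ‖b‖ ≤ B * √T) (hbT : √T ≤ B * -b.re) : IsAmplitude B T b (amplitude b) := by
  have hs : 0 < √T := Real.sqrt_pos.2 hT
  have hq : ∀ v : ℝ, ‖exp (2 * b * v)‖ = Real.exp (2 * b.re * v) := fun v => by
    rw [norm_exp, re_mul_ofReal]; simp
  have hden : ∀ v : ℝ, 1 - Real.exp (2 * b.re * v) ≤ ‖1 - exp (2 * b * v)‖ := fun v => by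
    have := norm_sub_norm_le 1 (exp (2 * b * v))
    rwa [norm_one, hq] at this
  have hexpb : ∀ v : ℝ, ‖exp (b * (v - 1 : ℝ))‖ ≤ Real.exp (‖b‖ * |v - 1|) := fun v => by
    refine (norm_exp_le_exp_norm _).trans ?_
    rw [norm_mul, norm_real, Real.norm_eq_abs]
  have hlt : ∀ v : ℝ, 0 < v → Real.exp (2 * b.re * v) < 1 := fun v hv => by
    rw [Real.exp_lt_one_iff]; nlinarith
  have hne : ∀ v : ℝ, 0 < v → 1 - exp (2 * b * v) ≠ 0 := fun v hv h => by
    have := hden v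
    rw [h, norm_zero] at this
    linarith [hlt v hv]
  refine ⟨?_, hb, ?_, ?_⟩
  · unfold amplitude
    exact ContinuousOn.div (by fun_prop) (by fun_prop) fun v hv => hne v hv
  · intro v hv
    have hv0 : 0 < v := by linarith
    have e : amplitude b v - exp (b * (v - 1 : ℝ)) =
        exp (2 * b * v) / (1 - exp (2 * b * v)) * exp (b * (v - 1 : ℝ)) := by
      have := hne v hv0
      rw [amplitude]
      generalize exp (2 * b * v) = q at this
      field_simp
      ring
    rw [e, norm_mul, norm_div, hq]
    refine mul_le_mul ?_ (hexpb v) (norm_nonneg _) (by positivity)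
    have hbre : 0 < -b.re := by linarith
    have hle : Real.exp (2 * b.re * v) ≤ Real.exp b.re := Real.exp_le_exp.2 (by nlinarith)
    have h2 : Real.exp b.re * (1 + -b.re) ≤ 1 := by
      have := Real.add_one_le_exp (-b.re)
      rw [Real.exp_neg, ← one_div, le_div_iff₀ (Real.exp_pos _)] at this
      linarith
    have hd := hden v
    have hpos : 0 < ‖1 - exp (2 * b * v)‖ := norm_pos_iff.2 (hne v hv0)
    calc Real.exp (2 * b.re * v) / ‖1 - exp (2 * b * v)‖ ≤ 1 / -b.re := by
          rw [div_le_div_iff₀ hpos hbre]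
          nlinarith [mul_le_mul_of_nonneg_right hle hbre.le]
      _ ≤ B / √T := by
          rw [div_le_div_iff₀ hbre hs]; linarith
  · intro v hv hv'
    have hd := hden v
    have hpos : 0 < ‖1 - exp (2 * b * v)‖ := norm_pos_iff.2 (hne v hv)
    rw [amplitude, norm_div, div_eq_mul_inv, mul_comm]
    refine mul_le_mul ?_ (hexpb v) (norm_nonneg _) (by positivity)
    have h2 : Real.exp (2 * b.re * v) ≤ Real.exp (-(2 * v)) := Real.exp_le_exp.2 (by nlinarith)
    have h3 : Real.exp (-(2 * v)) * (1 + 2 * v) ≤ 1 := by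
      have := Real.add_one_le_exp (2 * v)
      rw [Real.exp_neg, inv_mul_le_iff₀ (Real.exp_pos _)]
      linarith
    rw [inv_eq_one_div, div_le_div_iff₀ hpos hv]
    nlinarith [Real.exp_pos (-(2 * v))]

/-! ### The exact formula and the quotient of the integrals -/

/-- The saddle point integral for `𝓡(1 - τ)`. -/
noncomputable def auxIntegral (τ : ℂ) : ℂ :=
  ∫ v in Ioi (0 : ℝ), exp (-τ * phase v) *
    (amplitude (Real.pi * I * exp (logEta τ)) v / v)

/-- The saddle point integral for `Γ(τ)`. -/
noncomputable def gammaIntegral (τ : ℂ) : ℂ :=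
  ∫ v in Ioi (0 : ℝ), exp (-(2 * τ) * phase v) * (1 / v)

theorem logEta_eq {τ : ℂ} (hτ : τ ≠ 0) :
    logEta τ = Real.pi * I / 4 + (log τ - Real.log (2 * Real.pi)) / 2 := by
  have h : τ / (2 * Real.pi) = (((2 * Real.pi)⁻¹ : ℝ) : ℂ) * τ := by
    push_cast; rw [div_eq_inv_mul]
  rw [logEta, h, log_ofReal_mul (by have := Real.pi_pos; positivity) hτ, Real.log_inv]
  push_cast
  ring

theorem norm_exp_logEta_sq {τ : ℂ} (hτ : τ ≠ 0) :
    ‖exp (logEta τ)‖ ^ 2 = ‖τ‖ / (2 * Real.pi) := by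
  have hpi := Real.pi_pos
  rw [← norm_pow, exp_logEta_sq hτ, norm_div, norm_mul, norm_I, one_mul, norm_mul, norm_real,
    Real.norm_of_nonneg hpi.le, norm_ofNat]

/-- The exact form of the theorem: the two saddle point integrals replace `1 + O(|η|⁻¹)`. -/
theorem auxR_eq {s : ℂ} (hs : s.re < -1) (hL : gammaIntegral (1 - s) ≠ 0) :
    auxR s = exp (-(Real.pi * I / 8)) / (√2 : ℂ) * chi s * eta s ^ (s - 1) *
      exp (Real.pi * I * (eta s - eta s ^ 2)) *
      (auxIntegral (1 - s) / (exp (-(Real.pi * I / 8)) * √2 * gammaIntegral (1 - s))) := by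
  have hpi := Real.pi_pos
  have hpi0 : (Real.pi : ℂ) ≠ 0 := by exact_mod_cast hpi.ne'
  have hre : 2 ≤ (1 - s).re := by simp; linarith
  obtain ⟨τ, rfl⟩ : ∃ τ, s = 1 - τ := ⟨1 - s, by ring⟩
  rw [sub_sub_cancel] at hL hre ⊢
  have hτ0 : τ ≠ 0 := fun h => by simp [h] at hre; linarith
  have harg := abs_lt.1 (abs_arg_lt_pi_div_two_iff.2 (Or.inl (show 0 < τ.re by linarith)))
  have heta : eta (1 - τ) = exp (logEta τ) := by
    rw [← exp_logEta (by simpa using hτ0), sub_sub_cancel]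
  have hpow : eta (1 - τ) ^ (1 - τ - 1) = exp (-(τ * logEta τ)) := by
    rw [heta, cpow_def_of_ne_zero (exp_ne_zero _), log_exp
      (by rw [logEta_im]; linarith) (by rw [logEta_im]; linarith)]
    ring_nf
  have h2pi : (2 * Real.pi : ℂ) ^ (1 - τ - 1) = exp (-(τ * Real.log (2 * Real.pi))) := by
    rw [cpow_def_of_ne_zero (by simp [hpi0]), ofReal_log (by positivity)]
    push_cast
    ring_nf
  have hsq : Real.pi * I * (eta (1 - τ) - eta (1 - τ) ^ 2) =
      Real.pi * I * exp (logEta τ) + τ / 2 := by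
    rw [heta, mul_sub, exp_logEta_sq hτ0]
    field_simp
    linear_combination (-τ) * I_sq
  have hsin : exp (Real.pi * I * (1 - τ)) - 1 =
      exp (Real.pi * I * (1 - τ) / 2) * (2 * I * sin (Real.pi * (1 - τ) / 2)) := by
    rw [sin, show Real.pi * I * (1 - τ) = Real.pi * I * (1 - τ) / 2 + Real.pi * I * (1 - τ) / 2 by ring,
      exp_add, add_halves,
      show -(Real.pi * (1 - τ) / 2) * I = -(Real.pi * I * (1 - τ) / 2) by ring,
      show Real.pi * (1 - τ) / 2 * I = Real.pi * I * (1 - τ) / 2 by ring, exp_neg]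
    have := exp_ne_zero (Real.pi * I * (1 - τ) / 2)
    field_simp
    linear_combination (exp (Real.pi * I * (1 - τ) / 2) ^ 2 - 1) * I_sq
  have hsqrt : ((√2 : ℝ) : ℂ) ^ 2 = 2 := by
    rw [← ofReal_pow, Real.sq_sqrt (by norm_num)]; simp
  have hsqrt0 : ((√2 : ℝ) : ℂ) ≠ 0 := by
    exact_mod_cast (Real.sqrt_pos.2 (by norm_num : (0 : ℝ) < 2)).ne'
  -- From `2 log η = πi/2 + log τ - log 2π`: `η^τ` is traded for `η^{-τ} τ^τ (2π)^{-τ}`, the powers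
  -- in `η^{s-1}`, `Γ(1-s)` and `(2π)^{s-1}`.
  have hphase : exp (Real.pi * I * (1 - τ) / 2 + τ * logEta τ) =
      I * exp (τ * log τ - τ * Real.log (2 * Real.pi) - τ * logEta τ) := by
    conv_rhs => arg 1; rw [← exp_pi_div_two_mul_I]
    rw [← exp_add, logEta_eq hτ0]
    ring_nf
  rw [auxR_eq_integral_ray hs, sub_sub_cancel, integral_rayIntegrand_rotate hre,
    integral_rayIntegrand_eq_saddle hτ0, ← auxIntegral, hsin, chi, sub_sub_cancel,
    Gamma_eq_saddle (by linarith), ← gammaIntegral, hpow, h2pi, hsq]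
  set ε := exp (-(Real.pi * I / 8)) with hε
  have hε0 : ε ≠ 0 := exp_ne_zero _
  set E := exp (Real.pi * I * exp (logEta τ)) with hE
  have lhs : exp (Real.pi * I * (1 - τ) / 2) *
      exp (τ * logEta τ - τ / 2 + Real.pi * I * exp (logEta τ)) =
      I * exp (τ * log τ - τ * Real.log (2 * Real.pi) - τ * logEta τ) * exp (-(τ / 2)) * E := by
    rw [← hphase, hE, ← exp_add, ← exp_add, ← exp_add]; ring_nf
  have rhs : exp (-(τ * Real.log (2 * Real.pi))) * exp (τ * log τ - τ) * exp (-(τ * logEta τ)) *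
      exp (Real.pi * I * exp (logEta τ) + τ / 2) =
      exp (τ * log τ - τ * Real.log (2 * Real.pi) - τ * logEta τ) * exp (-(τ / 2)) * E := by
    rw [hE, ← exp_add, ← exp_add, ← exp_add, ← exp_add, ← exp_add]; ring_nf
  set W := exp (τ * log τ - τ * Real.log (2 * Real.pi) - τ * logEta τ) * exp (-(τ / 2)) * E with hW
  set Sn := sin (Real.pi * (1 - τ) / 2) with hSn
  calc _ = -(2 * I * Sn * auxIntegral τ) * (exp (Real.pi * I * (1 - τ) / 2) *
        exp (τ * logEta τ - τ / 2 + Real.pi * I * exp (logEta τ))) := by ring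
    _ = 2 * Sn * auxIntegral τ * W := by
        rw [lhs, hW]
        linear_combination (-2 * Sn * auxIntegral τ *
          (exp (τ * log τ - τ * Real.log (2 * Real.pi) - τ * logEta τ) * exp (-(τ / 2)) * E)) * I_sq
    _ = 2 * Sn * auxIntegral τ * (2 / (√2 : ℝ) ^ 2) * W := by rw [hsqrt]; ring
    _ = _ := by
        rw [← rhs]
        field_simp

theorem norm_sqrt_pi_div {τ : ℂ} (hτ : τ ≠ 0) :
    ‖(Real.pi / τ : ℂ) ^ (1 / 2 : ℂ)‖ = √Real.pi * (√‖τ‖)⁻¹ := by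
  have hpi := Real.pi_pos
  have h : (Real.pi / τ : ℂ) ≠ 0 := div_ne_zero (by exact_mod_cast hpi.ne') hτ
  have e : (1 / 2 : ℂ) = ((1 / 2 : ℝ) : ℂ) := by push_cast; ring
  rw [e, norm_cpow_real, norm_div, norm_real, Real.norm_of_nonneg hpi.le, ← Real.sqrt_eq_rpow,
    Real.sqrt_div hpi.le, div_eq_mul_inv]

/-- Matches the Gaussian of `Γ`, with parameter `2τ`, to that of `𝓡`. The factor `2` is positive, so
the principal power splits. -/
theorem sqrt_two_mul_sqrt_pi_div (τ : ℂ) :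
    (√2 : ℂ) * (Real.pi / (2 * τ)) ^ (1 / 2 : ℂ) = (Real.pi / τ) ^ (1 / 2 : ℂ) := by
  have h : (Real.pi / τ : ℂ) = ((2 : ℝ) : ℂ) * (Real.pi / (2 * τ)) := by
    rw [mul_div_assoc', ofReal_ofNat, mul_div_mul_left _ _ two_ne_zero]
  have e : (1 / 2 : ℂ) = ((1 / 2 : ℝ) : ℂ) := by push_cast; ring
  rw [h, cpow_def, cpow_def]
  by_cases h0 : (Real.pi / (2 * τ) : ℂ) = 0
  · simp [h0]
  rw [if_neg h0, if_neg (mul_ne_zero (by simp) h0), log_ofReal_mul (by norm_num) h0, add_mul, exp_add,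
    e, ← ofReal_mul, ← ofReal_exp, Real.sqrt_eq_rpow, Real.rpow_def_of_pos (by norm_num)]

/-- Both saddle point integrals, to first order. -/
theorem saddle_integrals_estimate {κ : ℝ} (hκ : 0 < κ) :
    ∃ C T₀, 0 ≤ C ∧ 1 ≤ T₀ ∧ ∀ τ : ℂ, T₀ ≤ ‖τ‖ → κ * ‖τ‖ ≤ τ.re →
      κ ≤ Real.sin (logEta τ).im →
      ‖auxIntegral τ - (Real.pi / τ) ^ (1 / 2 : ℂ) * exp (-(Real.pi * I / 8))‖ ≤ C * ‖τ‖⁻¹ ∧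
      ‖√2 * gammaIntegral τ - (Real.pi / τ) ^ (1 / 2 : ℂ)‖ ≤ C * ‖τ‖⁻¹ := by
  have hpi := Real.pi_gt_three
  have hpi4 := Real.pi_le_four
  -- The `2` serves `‖b‖ ≤ 2√‖τ‖`, and `κ⁻¹` serves `√‖τ‖ ≤ κ⁻¹ (-Re b)`.
  set B := 2 + κ⁻¹ with hB
  have hB1 : 1 ≤ B := by have : 0 < κ⁻¹ := by positivity
                         linarith
  obtain ⟨C, hC, h⟩ := saddle_point_estimate hκ (zero_le_one.trans hB1)
  -- `2 / κ` ensures `2 ≤ κ‖τ‖`; `κ⁻²` ensures `κ√‖τ‖ ≥ 1`, hence `Re b ≤ -1`.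
  refine ⟨2 * C, 1 + 2 / κ + (κ⁻¹) ^ 2, by positivity, by
    have : 0 ≤ 2 / κ + (κ⁻¹) ^ 2 := by positivity
    linarith, ?_⟩
  intro τ hT hre hsin
  have hT1 : 1 ≤ ‖τ‖ := le_trans (by
    have : 0 ≤ 2 / κ + (κ⁻¹) ^ 2 := by positivity
    linarith) hT
  have hT0 : 0 < ‖τ‖ := by linarith
  have hτ0 : τ ≠ 0 := norm_pos_iff.1 hT0
  have hκT : 2 ≤ κ * ‖τ‖ := by
    have : 2 / κ ≤ ‖τ‖ := le_trans (by
      have : 0 ≤ (κ⁻¹) ^ 2 := by positivity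
      linarith) hT
    rwa [div_le_iff₀' hκ] at this
  have hsT : κ⁻¹ ≤ √‖τ‖ := Real.le_sqrt_of_sq_le (le_trans (by
      have : 0 ≤ 2 / κ := by positivity
      linarith) hT)
  have hs0 : 0 < √‖τ‖ := Real.sqrt_pos.2 hT0
  constructor
  · set η := exp (logEta τ) with hη
    set b := Real.pi * I * η with hb
    have hnη : ‖η‖ ^ 2 = ‖τ‖ / (2 * Real.pi) := norm_exp_logEta_sq hτ0
    have hssq : (√‖τ‖) ^ 2 = ‖τ‖ := Real.sq_sqrt hT0.le
    have hbn : ‖b‖ = Real.pi * ‖η‖ := by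
      rw [hb, norm_mul, norm_mul, norm_I, norm_real, Real.norm_of_nonneg (by linarith), mul_one]
    have hbsq : (Real.pi * ‖η‖) ^ 2 = Real.pi / 2 * (√‖τ‖) ^ 2 := by
      rw [mul_pow, hnη, hssq]; field_simp
    have hble : ‖b‖ ≤ 2 * √‖τ‖ := by
      rw [hbn]
      refine le_of_sq_le_sq ?_ (by positivity)
      rw [hbsq]; nlinarith [sq_nonneg (√‖τ‖)]
    have hbge : √‖τ‖ ≤ Real.pi * ‖η‖ := by
      refine le_of_sq_le_sq ?_ (by positivity)
      rw [hbsq]; nlinarith [sq_nonneg (√‖τ‖)]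
    have hbre : κ * √‖τ‖ ≤ -b.re := by
      have : b.re = -(Real.pi * η.im) := by rw [hb, mul_assoc, re_ofReal_mul, I_mul_re]; ring
      rw [this, neg_neg]
      have him : η.im = ‖η‖ * Real.sin (logEta τ).im := by rw [hη, norm_exp, exp_im]
      rw [him]
      have h1 := mul_le_mul hbge hsin hκ.le (by positivity)
      linarith
    have hκs : 1 ≤ κ * √‖τ‖ := by rwa [inv_le_iff_one_le_mul₀' hκ] at hsT
    have hamp : IsAmplitude B ‖τ‖ b (amplitude b) := by
      refine isAmplitude_amplitude hB1 hT0 (by linarith) (hble.trans ?_) ?_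
      · gcongr
        have : 0 < κ⁻¹ := by positivity
        linarith
      · have h1 : √‖τ‖ ≤ κ⁻¹ * -b.re := by rwa [le_inv_mul_iff₀ hκ]
        rw [hB, add_mul]
        have : 0 ≤ 2 * -b.re := by linarith
        linarith
    have key := h τ b (amplitude b) hT1 hκT hre hamp
    have hexp : b ^ 2 / (4 * τ) = -(Real.pi * I / 8) := by
      have hpi0 : (Real.pi : ℂ) ≠ 0 := by exact_mod_cast Real.pi_ne_zero
      rw [hb, mul_pow, hη, exp_logEta_sq hτ0, mul_pow, I_sq]
      field_simp
      ring
    rw [hexp] at key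
    refine key.trans ?_
    gcongr
    linarith
  · have h2 : ‖2 * τ‖ = 2 * ‖τ‖ := by rw [norm_mul, norm_ofNat]
    have key := h (2 * τ) 0 (fun _ => 1) (by rw [h2]; linarith) (by rw [h2]; linarith)
      (by rw [h2, show (2 * τ).re = 2 * τ.re by simp]; linarith) (isAmplitude_one hB1)
    rw [zero_pow two_ne_zero, zero_div, exp_zero, mul_one] at key
    rw [← sqrt_two_mul_sqrt_pi_div, ← mul_sub, norm_mul, norm_real, Real.norm_of_nonneg (by positivity)]
    have hs2 : √2 ≤ 2 := Real.sqrt_le_iff.2 ⟨by norm_num, by norm_num⟩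
    refine mul_le_mul hs2 (key.trans ?_) (norm_nonneg _) (by norm_num) |>.trans
      (le_of_eq (by ring : 2 * (C * ‖τ‖⁻¹) = 2 * C * ‖τ‖⁻¹))
    gcongr
    rw [h2]; linarith

/-- The quotient of the two saddle point integrals is `e^{-πi/8}√2 (1 + O(|η|⁻¹))`. -/
theorem quotient_estimate {κ : ℝ} (hκ : 0 < κ) :
    ∃ C T₀, ∀ τ : ℂ, T₀ ≤ ‖τ‖ → κ * ‖τ‖ ≤ τ.re → κ ≤ Real.sin (logEta τ).im →
      gammaIntegral τ ≠ 0 ∧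
      ‖auxIntegral τ / (exp (-(Real.pi * I / 8)) * √2 * gammaIntegral τ) - 1‖ ≤
        C * ‖exp (logEta τ)‖⁻¹ := by
  obtain ⟨C, T₀, hC, hT₀, h⟩ := saddle_integrals_estimate hκ
  have hpi := Real.pi_gt_three
  -- Beyond `4C²` the error in `L` is at most half of `‖τ‖^{-1/2} ≤ ‖S‖`, so `L` is bounded away
  -- from `0`.
  refine ⟨4 * C, max T₀ (4 * C ^ 2), ?_⟩
  intro τ hT hre hsin
  obtain ⟨h1, h2⟩ := h τ ((le_max_left _ _).trans hT) hre hsin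
  have hT1 : 1 ≤ ‖τ‖ := hT₀.trans ((le_max_left _ _).trans hT)
  have hT0 : 0 < ‖τ‖ := by linarith
  have hτ0 : τ ≠ 0 := norm_pos_iff.1 hT0
  have hs0 : 0 < √‖τ‖ := Real.sqrt_pos.2 hT0
  have hss : ‖τ‖⁻¹ = (√‖τ‖)⁻¹ * (√‖τ‖)⁻¹ := by rw [← mul_inv, Real.mul_self_sqrt hT0.le]
  have hCs : C * (√‖τ‖)⁻¹ ≤ 1 / 2 := by
    rw [← div_eq_mul_inv, div_le_iff₀ hs0]
    have : 2 * C ≤ √‖τ‖ := Real.le_sqrt_of_sq_le (by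
      have := (le_max_right _ _).trans hT
      linarith)
    linarith
  set S := (Real.pi / τ : ℂ) ^ (1 / 2 : ℂ) with hS
  have hSn : (√‖τ‖)⁻¹ ≤ ‖S‖ := by
    rw [hS, norm_sqrt_pi_div hτ0]
    exact le_mul_of_one_le_left (by positivity) (Real.one_le_sqrt.2 (by linarith))
  set L := (√2 : ℂ) * gammaIntegral τ with hL
  set K := auxIntegral τ with hK
  set ε := exp (-(Real.pi * I / 8)) with hε
  have hε1 : ‖ε‖ = 1 := by
    rw [hε, show -(Real.pi * I / 8 : ℂ) = ((-Real.pi / 8 : ℝ) : ℂ) * I by push_cast; ring,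
      norm_exp_ofReal_mul_I]
  have hε0 : ε ≠ 0 := exp_ne_zero _
  have hLn : (√‖τ‖)⁻¹ / 2 ≤ ‖L‖ := by
    have h3 : ‖S‖ - ‖L‖ ≤ C * ‖τ‖⁻¹ := by
      have := norm_sub_norm_le S L
      rw [norm_sub_rev] at this
      exact this.trans h2
    rw [hss] at h3
    nlinarith [inv_pos.2 hs0]
  have hL0 : L ≠ 0 := norm_pos_iff.1 (lt_of_lt_of_le (by positivity) hLn)
  refine ⟨right_ne_zero_of_mul hL0, ?_⟩
  have e : K / (ε * √2 * gammaIntegral τ) - 1 = ((K - S * ε) - ε * (L - S)) / (ε * L) := by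
    rw [mul_assoc, ← hL]
    field_simp
    ring
  have hη : √‖τ‖ ≥ ‖exp (logEta τ)‖ := by
    refine le_of_sq_le_sq ?_ hs0.le
    rw [norm_exp_logEta_sq hτ0, Real.sq_sqrt hT0.le]
    exact div_le_self hT0.le (by linarith)
  have hη0 : 0 < ‖exp (logEta τ)‖ := norm_pos_iff.2 (exp_ne_zero _)
  have hnum : ‖(K - S * ε) - ε * (L - S)‖ ≤ 2 * C * ‖τ‖⁻¹ := by
    refine (norm_sub_le _ _).trans ?_
    rw [norm_mul, hε1, one_mul]
    linarith
  rw [e, norm_div, norm_mul, hε1, one_mul]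
  calc _ ≤ 2 * C * ‖τ‖⁻¹ / ((√‖τ‖)⁻¹ / 2) := by gcongr
    _ = 4 * C * (√‖τ‖)⁻¹ := by rw [hss]; field_simp; ring
    _ ≤ _ := by gcongr

/-! ### The sector `G α` and the conclusion -/

/-- On `G α`, `τ = 1 - s` lies in a sector about the positive real axis. -/
theorem abs_arg_le_of_mem_G {α : ℝ} (hα0 : 0 < α) (hα : α < Real.pi / 4) {s : ℂ} (hs : s ∈ G α) :
    |(1 - s).arg| ≤ Real.pi / 2 - 2 * α := by
  have hcos : 0 < Real.cos (2 * α) := Real.cos_pos_of_mem_Ioo ⟨by linarith, by linarith⟩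
  have hs' : |(1 - s).im| * Real.tan (2 * α) ≤ (1 - s).re := by
    have : |s.im| * Real.tan (2 * α) ≤ 1 - s.re := hs
    simpa using this
  set τ := 1 - s
  by_cases hτ : τ = 0
  · rw [hτ, arg_zero, abs_zero]; linarith
  have hn : 0 < ‖τ‖ := norm_pos_iff.2 hτ
  by_contra hcon
  push Not at hcon
  have harg := abs_arg_le_pi τ
  have him : |τ.im| = ‖τ‖ * Real.sin |τ.arg| := by
    rw [← Real.abs_sin_eq_sin_abs_of_abs_le_pi harg, sin_arg, abs_div, abs_norm]
    field_simp
  have hre : τ.re = ‖τ‖ * Real.cos |τ.arg| := by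
    rw [Real.cos_abs, cos_arg hτ]; field_simp
  rw [him, hre, Real.tan_eq_sin_div_cos, mul_div_assoc', div_le_iff₀ hcos] at hs'
  -- Multiplied by `cos 2α`, the defining inequality of `G α` is the addition formula for this
  -- cosine.
  have h1 : 0 ≤ ‖τ‖ * Real.cos (|τ.arg| + 2 * α) := by rw [Real.cos_add]; linarith
  have h2 : Real.cos (|τ.arg| + 2 * α) < 0 :=
    Real.cos_neg_of_pi_div_two_lt_of_lt (by linarith) (by linarith)
  nlinarith

/-- Here `arg η` lies in `[α, π/2 - α]`. This keeps `-Re b = π Im η` comparable to `|η|`. -/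
theorem sin_le_sin_logEta_im {α : ℝ} (hα0 : 0 < α) {τ : ℂ}
    (hτ : |τ.arg| ≤ Real.pi / 2 - 2 * α) : Real.sin α ≤ Real.sin (logEta τ).im := by
  have h := abs_le.1 hτ
  have hpi := Real.pi_pos
  rw [logEta_im]
  rcases le_total (Real.pi / 4 + τ.arg / 2) (Real.pi / 2) with h' | h'
  · exact Real.sin_le_sin_of_le_of_le_pi_div_two (by linarith) h' (by linarith)
  · rw [← Real.sin_pi_sub (Real.pi / 4 + τ.arg / 2)]
    exact Real.sin_le_sin_of_le_of_le_pi_div_two (by linarith) (by linarith) (by linarith)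

theorem sin_two_mul_norm_le_re {α : ℝ} (hα0 : 0 < α) {τ : ℂ}
    (hτ : |τ.arg| ≤ Real.pi / 2 - 2 * α) : Real.sin (2 * α) * ‖τ‖ ≤ τ.re := by
  have hpi := Real.pi_pos
  by_cases h0 : τ = 0
  · simp [h0]
  have hn : 0 < ‖τ‖ := norm_pos_iff.2 h0
  have h1 : Real.cos (Real.pi / 2 - 2 * α) ≤ Real.cos |τ.arg| :=
    Real.cos_le_cos_of_nonneg_of_le_pi (abs_nonneg _) (by linarith) hτ
  rw [Real.cos_pi_div_two_sub, Real.cos_abs, cos_arg h0, le_div_iff₀ hn] at h1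
  exact h1

end RiemannAux

theorem mainTheorem4 (α : ℝ) (hα0 : 0 < α) (hα : α < Real.pi / 4) :
    ∃ U : ℂ → ℂ,
      U =O[Bornology.cobounded ℂ ⊓ 𝓟 (RiemannAux.G α)] (fun s => ‖RiemannAux.eta s‖⁻¹) ∧
      ∀ᶠ s in Bornology.cobounded ℂ ⊓ 𝓟 (RiemannAux.G α),
        RiemannAux.auxR s =
          Complex.exp (-(Real.pi * Complex.I / 8)) / (Real.sqrt 2 : ℂ) *
            RiemannAux.chi s * RiemannAux.eta s ^ (s - 1) *
            Complex.exp (Real.pi * Complex.I * (RiemannAux.eta s - RiemannAux.eta s ^ 2)) *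
            (1 + U s) := by
  have hpi := Real.pi_pos
  set κ := min (Real.sin α) (Real.sin (2 * α)) with hκdef
  have hκ : 0 < κ := lt_min (Real.sin_pos_of_pos_of_lt_pi hα0 (by linarith))
    (Real.sin_pos_of_pos_of_lt_pi (by linarith) (by linarith))
  obtain ⟨C, T₀, h⟩ := RiemannAux.quotient_estimate hκ
  have hlarge : ∀ᶠ s in Bornology.cobounded ℂ ⊓ 𝓟 (RiemannAux.G α),
      s.re < -1 ∧ RiemannAux.gammaIntegral (1 - s) ≠ 0 ∧
      ‖RiemannAux.auxIntegral (1 - s) / (Complex.exp (-(Real.pi * Complex.I / 8)) *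
        (Real.sqrt 2 : ℂ) * RiemannAux.gammaIntegral (1 - s)) - 1‖ ≤
        C * ‖Complex.exp (RiemannAux.logEta (1 - s))‖⁻¹ := by
    rw [eventually_inf_principal]
    -- The `1` pays for passing from `s` to `1 - s`; `4 / κ` forces `Re (1 - s) ≥ 4`, hence `Re s <
    -- -1`.
    filter_upwards [tendsto_norm_cobounded_atTop.eventually_ge_atTop (1 + max T₀ (4 / κ))]
      with s hs hG
    have hT : max T₀ (4 / κ) ≤ ‖1 - s‖ := by
      have := norm_sub_norm_le s 1
      rw [norm_one, norm_sub_rev] at this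
      linarith
    have harg := RiemannAux.abs_arg_le_of_mem_G hα0 hα hG
    have hre : κ * ‖1 - s‖ ≤ (1 - s).re :=
      (mul_le_mul_of_nonneg_right (min_le_right _ _) (norm_nonneg _)).trans
        (RiemannAux.sin_two_mul_norm_le_re hα0 harg)
    refine ⟨?_, h _ ((le_max_left _ _).trans hT) hre
      ((min_le_left _ _).trans (RiemannAux.sin_le_sin_logEta_im hα0 harg))⟩
    have h3 := (le_max_right _ _).trans hT
    rw [div_le_iff₀' hκ] at h3
    have h4 := h3.trans hre
    simp only [Complex.sub_re, Complex.one_re] at h4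
    linarith
  refine ⟨fun s => RiemannAux.auxIntegral (1 - s) / (Complex.exp (-(Real.pi * Complex.I / 8)) *
    (Real.sqrt 2 : ℂ) * RiemannAux.gammaIntegral (1 - s)) - 1, ?_, ?_⟩
  · refine IsBigO.of_bound C ?_
    filter_upwards [hlarge] with s hs
    have hs1 : 1 - s ≠ 0 := fun h0 => by
      have := congrArg Complex.re h0
      simp only [Complex.sub_re, Complex.one_re, Complex.zero_re] at this
      linarith [hs.1]
    rw [norm_inv, norm_norm, ← RiemannAux.exp_logEta hs1]
    exact hs.2.2
  · filter_upwards [hlarge] with s hs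
    rw [add_sub_cancel]
    exact RiemannAux.auxR_eq hs.1 hs.2.1
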